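/- Let $\gamma$ be the standard Gaussian measure on $\mathbb{R}^n$, $d\gamma=(2\pi)^{-n/2}e^{-|x|^2/2}\,dx$. For a nonempty bounded open set $\Omega\subset\mathbb{R}^n$ with Lipschitz boundary let $$\lambda_\gamma(\Omega)=\inf\left\{\frac{\int_\Omega|\nabla w|^2\,d\gamma}{\int_\Omega w^2\,d\gamma}\;:\; w\in W^{1,2}_0(\Omega,\gamma)\setminus\{0\}\right\}$$ be the first Dirichlet eigenvalue of the Ornstein--Uhlenbeck operator $\Delta-\langle x,\nabla\rangle$ on $\Omega$, where $W^{1,2}_0(\Omega,\gamma)$ is the closure of $C_c^\infty(\Omega)$ in the weighted Sobolev space $W^{1,2}(\Omega,\gamma)$. Let $B_R=\{|x|<R\}$, and let ${}_1F_1(a;b;s)=\sum_{k\ge0}\frac{(a)_k}{(b)_k}\frac{s^k}{k!}$ be Kummer's function. Then: 1. For every $n\ge1$ and $R>0$, $\lambda_\gamma(B_R)$ is the smallest $\lambda>0$ with ${}_1F_1\left(-\frac{\lambda}{2};\frac n2;\frac{R^2}{2}\right)=0$. 2. Let $n=2$ and $t=\frac12$. Then $(1-t)B_4+tB_6=B_5$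 (Minkowski combination), and $$|\lambda_\gamma(B_4)-0.0045931899|<10^{-10},\quad |\lambda_\gamma(B_6)-0.0000005157|<10^{-10},\quad |\lambda_\gamma(B_5)-0.0000848928|<10^{-10},$$ $$\left|\left(\lambda_\gamma(B_5)^{-1/2}-\tfrac12\lambda_\gamma(B_4)^{-1/2}-\tfrac12\lambda_\gamma(B_6)^{-1/2}\right)-(-595)\right|<\tfrac12;$$ in particular $$\lambda_\gamma\left((1-t)B_4+tB_6\right)^{-1/2}<(1-t)\lambda_\gamma(B_4)^{-1/2}+t\lambda_\gamma(B_6)^{-1/2}.$$ 3. Consequently, in $\mathbb{R}^2$ the inequality $$\lambda_\gamma(\Omega_t)^{-1/2}\ge(1-t)\lambda_\gamma(\Omega_0)^{-1/2}+t\lambda_\gamma(\Omega_1)^{-1/2},\qquad \Omega_t=(1-t)\Omega_0+t\Omega_1,$$ does not hold for all $t\in[0,1]$ and all nonempty, open, bounded, convex sets $\Omega_0,\Omega_1$ that are centrally symmetric ($-\Omega_i=\Omega_i$). This answers negatively a question of Colesanti, Francini, Livshyts and Salani. -/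

import Mathlib

open MeasureTheory Set
open scoped Pointwise ContDiff

noncomputable section

namespace GaussEigenvalue

/-- The standard Gaussian measure on `ℝⁿ`, with density `(2π)^(-n/2) exp(-|x|²/2)`. -/
def gaussMeasure (n : ℕ) : Measure (EuclideanSpace ℝ (Fin n)) :=
  volume.withDensity fun x =>
    ENNReal.ofReal ((2 * Real.pi) ^ (-(n : ℝ) / 2) * Real.exp (-‖x‖ ^ 2 / 2))

/-- `φ ∈ C_c^∞(Ω)`. -/
structure IsTestFunction {n : ℕ} (Ω : Set (EuclideanSpace ℝ (Fin n)))
    (φ : EuclideanSpace ℝ (Fin n) → ℝ) : Prop where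
  smooth : ContDiff ℝ ∞ φ
  hasCompactSupport : HasCompactSupport φ
  tsupport_subset : tsupport φ ⊆ Ω

/-- `G` is the weak (distributional) gradient of `u` in `Ω`, tested against `C_c^∞(Ω)` with
respect to the Lebesgue measure. -/
structure HasWeakGradient {n : ℕ} (Ω : Set (EuclideanSpace ℝ (Fin n)))
    (u : EuclideanSpace ℝ (Fin n) → ℝ)
    (G : EuclideanSpace ℝ (Fin n) → EuclideanSpace ℝ (Fin n)) : Prop where
  locallyIntegrableOn : LocallyIntegrableOn u Ω
  locallyIntegrableOn_grad : LocallyIntegrableOn G Ω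
  integral_eq : ∀ φ, IsTestFunction Ω φ →
    ∫ x in Ω, u x • gradient φ x = -∫ x in Ω, φ x • G x

/-- `u ∈ W^{1,2}(Ω, γ)`, with weak gradient `G`. -/
structure MemW12 {n : ℕ} (Ω : Set (EuclideanSpace ℝ (Fin n)))
    (u : EuclideanSpace ℝ (Fin n) → ℝ)
    (G : EuclideanSpace ℝ (Fin n) → EuclideanSpace ℝ (Fin n)) : Prop where
  memLp : MemLp u 2 ((gaussMeasure n).restrict Ω)
  memLp_grad : MemLp G 2 ((gaussMeasure n).restrict Ω)
  hasWeakGradient : HasWeakGradient Ω u G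

/-- `u ∈ W^{1,2}_0(Ω, γ)`, with weak gradient `G`: the closure of `C_c^∞(Ω)` in
`W^{1,2}(Ω, γ)`. On bounded Lipschitz domains these are the functions of zero trace. -/
structure MemW120 {n : ℕ} (Ω : Set (EuclideanSpace ℝ (Fin n)))
    (u : EuclideanSpace ℝ (Fin n) → ℝ)
    (G : EuclideanSpace ℝ (Fin n) → EuclideanSpace ℝ (Fin n)) : Prop
    extends MemW12 Ω u G where
  approx : ∀ ε : ℝ, 0 < ε → ∃ φ, IsTestFunction Ω φ ∧
    (∫ x in Ω, (u x - φ x) ^ 2 ∂(gaussMeasure n)) +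
      (∫ x in Ω, ‖G x - gradient φ x‖ ^ 2 ∂(gaussMeasure n)) < ε

/-- The first Dirichlet eigenvalue of the Ornstein-Uhlenbeck operator: the infimum of the
Rayleigh quotient over the nonzero elements of `W^{1,2}_0(Ω, γ)`. -/
def lambdaGamma {n : ℕ} (Ω : Set (EuclideanSpace ℝ (Fin n))) : ℝ :=
  sInf {q : ℝ | ∃ u G, MemW120 Ω u G ∧ ¬ (u =ᵐ[(gaussMeasure n).restrict Ω] 0) ∧
    q = (∫ x in Ω, ‖G x‖ ^ 2 ∂(gaussMeasure n)) / (∫ x in Ω, u x ^ 2 ∂(gaussMeasure n))}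

/-- The Minkowski combination `(1 - t) Ω₀ + t Ω₁`. -/
def minkowskiComb {n : ℕ} (t : ℝ) (Ω₀ Ω₁ : Set (EuclideanSpace ℝ (Fin n))) :
    Set (EuclideanSpace ℝ (Fin n)) :=
  (1 - t) • Ω₀ + t • Ω₁

/-- Kummer's function `₁F₁(a; b; s) = ∑ (a)_k / (b)_k * s^k / k!`; the series converges
absolutely for every `s` as soon as `b > 0`. -/
def kummerM (a b s : ℝ) : ℝ :=
  ∑' k : ℕ, (ascPochhammer ℝ k).eval a / (ascPochhammer ℝ k).eval b * s ^ k / (k.factorial : ℝ)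

end GaussEigenvalue

end

/-! Write `M = ₁F₁`. The radial function `u(x) = M(-l/2; n/2; |x|²/2)` solves `Δu - ⟨x, ∇u⟩ = -l u`,
because in the variable `s = |x|²/2` this is Kummer's equation.

If `u > 0` on a set, testing the weak equation with `φ²/u` (Barta's argument) bounds every Rayleigh
quotient there from below by `l`. If moreover `u` vanishes on the sphere of radius `R`, smooth
truncations show that `u` lies in `W^{1,2}_0` of the ball and has Rayleigh quotient exactly `l`. So
the eigenvalue is `l` as soon as `M(-l/2; n/2; ·)` is positive on `[0, R²/2)` and zero at `R²/2`.
The smallest `l` at which strict positivity on `[0, R²/2]` breaks down has this property: as long as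
`M` stays nonnegative it is strictly decreasing in `s`, so its first zero sits at the endpoint.

In the plane, `λ(B_R)` decays roughly like `exp(-R²/2)`, so `λ(B_R)^(-1/2)` grows roughly like
`exp(R²/4)` and cannot be concave in `R` for large `R`. Radii 4, 5, 6 already show this: the values
are about 14.7, 108.5 and 1392. They are certified by rational bounds on Kummer's series:
`kummerM_one_le_kummerHorner` from above and `kummerHorner_le_kummerM_one` from below. -/

namespace GaussEigenvalue

/-! ### Kummer's series: convergence, smoothness and differential equation -/

/-- The `k`-th term of Kummer's series. -/
noncomputable def kummerTerm (a b s : ℝ) (k : ℕ) : ℝ :=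
  (ascPochhammer ℝ k).eval a / (ascPochhammer ℝ k).eval b * s ^ k / (k.factorial : ℝ)

lemma kummerM_eq_tsum (a b s : ℝ) : kummerM a b s = ∑' k, kummerTerm a b s k := rfl

@[simp]
lemma kummerTerm_zero (a b s : ℝ) : kummerTerm a b s 0 = 1 := by simp [kummerTerm]

lemma kummerTerm_succ {b : ℝ} (hb : 0 < b) (a s : ℝ) (k : ℕ) :
    kummerTerm a b s (k + 1) = kummerTerm a b s k * ((a + k) * s / ((b + k) * (k + 1))) := by
  have h1 := (ascPochhammer_pos k b hb).ne'
  have h2 : b + k ≠ 0 := by positivity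
  have h3 : (k.factorial : ℝ) ≠ 0 := by positivity
  have h4 : (k : ℝ) + 1 ≠ 0 := by positivity
  simp only [kummerTerm, ascPochhammer_succ_eval, Nat.factorial_succ, Nat.cast_mul, Nat.cast_succ,
    pow_succ]
  field_simp

/-- Coefficient comparison behind `M' = (a/b) M(a+1; b+1; ·)`. It serves both for differentiating
the series and for summing `k` times its terms. -/
lemma succ_mul_kummerTerm_succ {b : ℝ} (hb : 0 < b) (a s : ℝ) (k : ℕ) :
    (k + 1) * kummerTerm a b s (k + 1) = s * (a / b * kummerTerm (a + 1) (b + 1) s k) := by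
  induction k with
  | zero => simp [kummerTerm_succ hb]; ring
  | succ k ih =>
    rw [kummerTerm_succ hb, kummerTerm_succ (by positivity : 0 < b + 1)]
    have h2 : b + 1 + k ≠ 0 := by positivity
    have h4 : (k : ℝ) + 1 ≠ 0 := by positivity
    have h5 : (k : ℝ) + 1 + 1 ≠ 0 := by positivity
    have h6 : b + (k + 1) ≠ 0 := by positivity
    have : kummerTerm a b s (k + 1) =
        s * (a / b * kummerTerm (a + 1) (b + 1) s k) / (k + 1) := by
      rw [← ih]; field_simp
    rw [this]
    push_cast
    field_simp
    ring

lemma kummerTerm_pos {A b S : ℝ} (hA : 0 < A) (hb : 0 < b) (hS : 0 < S) (k : ℕ) :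
    0 < kummerTerm A b S k := by
  have := ascPochhammer_pos k b hb
  have := ascPochhammer_pos k A hA
  unfold kummerTerm
  positivity

lemma summable_kummerTerm_of_pos {A b S : ℝ} (hA : 0 < A) (hb : 0 < b) (hS : 0 < S) :
    Summable (kummerTerm A b S) := by
  refine summable_of_ratio_test_tendsto_lt_one (l := 0) one_pos
    (Filter.Eventually.of_forall fun k => (kummerTerm_pos hA hb hS k).ne') ?_
  have h : ∀ k : ℕ, ‖kummerTerm A b S (k + 1)‖ / ‖kummerTerm A b S k‖ =
      (A + k) / (b + k) * (S / (k + 1)) := by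
    intro k
    have h0 := kummerTerm_pos hA hb hS k
    have h2 : b + k ≠ 0 := by positivity
    have h4 : (k : ℝ) + 1 ≠ 0 := by positivity
    rw [Real.norm_of_nonneg h0.le, Real.norm_of_nonneg (kummerTerm_pos hA hb hS (k + 1)).le,
      kummerTerm_succ hb]
    field_simp
  simp_rw [h]
  have h1 : Filter.Tendsto (fun k : ℕ => S / ((k : ℝ) + 1)) Filter.atTop (nhds 0) :=
    tendsto_const_div_atTop_nhds_zero_nat S |>.comp (Filter.tendsto_add_atTop_nat 1) |>.congr
      fun k => by simp
  refine squeeze_zero (g := fun k : ℕ => (A / b + 1) * (S / (k + 1)))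
    (fun k => by positivity) (fun k => ?_) (by simpa using h1.const_mul (A / b + 1))
  gcongr
  have h2 : 0 < b + k := by positivity
  rw [div_le_iff₀ h2]
  have : A = A / b * b := by field_simp
  have : 0 ≤ A / b * k := by positivity
  nlinarith

/-- Each factor of the recursion only grows when `a` and `s` are replaced by bounds for their
absolute values. The majorant is uniform on bounded sets of `(a, s)`, which yields joint continuity
and termwise differentiation. -/
lemma abs_kummerTerm_le {a A b s S : ℝ} (hb : 0 < b) (ha : |a| ≤ A) (hs : |s| ≤ S) (k : ℕ) :
    |kummerTerm a b s k| ≤ kummerTerm A b S k := by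
  have hA : 0 ≤ A := (abs_nonneg a).trans ha
  have hS : 0 ≤ S := (abs_nonneg s).trans hs
  induction k with
  | zero => simp
  | succ k ih =>
    rw [kummerTerm_succ hb, kummerTerm_succ hb, abs_mul]
    have h2 : 0 < (b + k) * ((k : ℝ) + 1) := by positivity
    refine mul_le_mul ih ?_ (abs_nonneg _) ((abs_nonneg _).trans ih)
    rw [abs_div, abs_mul, abs_of_pos h2]
    gcongr
    exact (abs_add_le _ _).trans (by simpa using ha)

lemma summable_kummerTerm {b : ℝ} (hb : 0 < b) (a s : ℝ) : Summable (kummerTerm a b s) :=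
  Summable.of_norm_bounded
    -- Adding 1 makes the parameters strictly positive, so no term of the majorant vanishes and the
    -- ratio test applies.
    (summable_kummerTerm_of_pos (A := |a| + 1) (S := |s| + 1) (by positivity) hb (by positivity))
    fun k => abs_kummerTerm_le hb (by linarith) (by linarith) k

lemma hasSum_kummerM {b : ℝ} (hb : 0 < b) (a s : ℝ) :
    HasSum (kummerTerm a b s) (kummerM a b s) := (summable_kummerTerm hb a s).hasSum

lemma continuous_kummerTerm (b : ℝ) (k : ℕ) :
    Continuous fun p : ℝ × ℝ => kummerTerm p.1 b p.2 k := by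
  unfold kummerTerm
  have h : Continuous fun p : ℝ × ℝ => (ascPochhammer ℝ k).eval p.1 :=
    (ascPochhammer ℝ k).continuous.comp continuous_fst
  fun_prop

lemma continuous_kummerM {b : ℝ} (hb : 0 < b) :
    Continuous fun p : ℝ × ℝ => kummerM p.1 b p.2 := by
  rw [continuous_iff_continuousAt]
  rintro ⟨a, s⟩
  have hU : Metric.ball (0 : ℝ) (|a| + 1) ×ˢ Metric.ball (0 : ℝ) (|s| + 1) ∈ nhds (a, s) :=
    prod_mem_nhds (Metric.isOpen_ball.mem_nhds (by simp))
      (Metric.isOpen_ball.mem_nhds (by simp))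
  refine ContinuousOn.continuousAt ?_ hU
  refine continuousOn_tsum (f := fun k (p : ℝ × ℝ) => kummerTerm p.1 b p.2 k)
    (fun k => (continuous_kummerTerm b k).continuousOn)
    (summable_kummerTerm_of_pos (A := |a| + 1) (S := |s| + 1) (by positivity) hb (by positivity)) ?_
  rintro k ⟨x, y⟩ ⟨hx, hy⟩
  exact abs_kummerTerm_le hb (mem_ball_zero_iff.1 hx).le (mem_ball_zero_iff.1 hy).le k

lemma hasDerivAt_kummerTerm_succ {b : ℝ} (hb : 0 < b) (a s : ℝ) (k : ℕ) :
    HasDerivAt (fun s => kummerTerm a b s (k + 1)) (a / b * kummerTerm (a + 1) (b + 1) s k) s := by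
  have h := (((hasDerivAt_pow (k + 1) s).const_mul
    ((ascPochhammer ℝ (k + 1)).eval a / (ascPochhammer ℝ (k + 1)).eval b)).div_const
      ((k + 1).factorial : ℝ))
  refine h.congr_deriv ?_
  have h1 := succ_mul_kummerTerm_succ hb a 1 k
  simp only [kummerTerm, one_pow, mul_one, one_mul] at h1 ⊢
  push_cast at h1 ⊢
  linear_combination s ^ k * h1

lemma hasDerivAt_kummerM {b : ℝ} (hb : 0 < b) (a s : ℝ) :
    HasDerivAt (kummerM a b) (a / b * kummerM (a + 1) (b + 1) s) s := by
  have hb1 : 0 < b + 1 := by positivity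
  have hS : 0 < |s| + 1 := by positivity
  have h0 : ∀ y, kummerM a b y = 1 + ∑' k, kummerTerm a b y (k + 1) := by
    intro y
    rw [kummerM_eq_tsum, (summable_kummerTerm hb a y).tsum_eq_zero_add, kummerTerm_zero]
  have h := hasDerivAt_tsum_of_isPreconnected
    (u := fun k => |a / b| * kummerTerm (|a + 1| + 1) (b + 1) (|s| + 1) k)
    (g := fun k y => kummerTerm a b y (k + 1))
    (g' := fun k y => a / b * kummerTerm (a + 1) (b + 1) y k)
    (t := Metric.ball (0 : ℝ) (|s| + 1)) (y₀ := s) (y := s)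
    ((summable_kummerTerm_of_pos (by positivity) hb1 hS).mul_left _)
    Metric.isOpen_ball (convex_ball _ _).isPreconnected
    (fun k y _ => hasDerivAt_kummerTerm_succ hb a y k)
    (fun k y hy => by
      rw [norm_mul]
      exact mul_le_mul_of_nonneg_left (abs_kummerTerm_le hb1 (by linarith)
        (mem_ball_zero_iff.1 hy |>.le) k) (abs_nonneg _))
    (by simp) ((summable_nat_add_iff 1).2 (summable_kummerTerm hb a s)) (by simp)
  rw [tsum_mul_left] at h
  exact (h.const_add 1).congr_of_eventuallyEq (Filter.Eventually.of_forall h0)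

lemma differentiable_kummerM {b : ℝ} (hb : 0 < b) (a : ℝ) : Differentiable ℝ (kummerM a b) :=
  fun s => (hasDerivAt_kummerM hb a s).differentiableAt

lemma contDiff_kummerM {b : ℝ} (hb : 0 < b) (a : ℝ) : ContDiff ℝ ∞ (kummerM a b) := by
  rw [contDiff_infty]
  intro m
  induction m generalizing a b with
  | zero => simpa using (differentiable_kummerM hb a).continuous
  | succ m ih =>
    rw [Nat.cast_succ, contDiff_succ_iff_deriv]
    refine ⟨differentiable_kummerM hb a, by simp, ?_⟩
    rw [show deriv (kummerM a b) = fun s => a / b * kummerM (a + 1) (b + 1) s from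
      funext fun s => (hasDerivAt_kummerM hb a s).deriv]
    exact contDiff_const.mul (ih (by positivity) _)

@[simp]
lemma kummerM_zero_right {b : ℝ} (a : ℝ) : kummerM a b 0 = 1 := by
  rw [kummerM_eq_tsum, tsum_eq_single 0, kummerTerm_zero]
  intro k hk
  simp [kummerTerm, hk]

@[simp]
lemma kummerM_zero_left (b s : ℝ) : kummerM 0 b s = 1 := by
  rw [kummerM_eq_tsum, tsum_eq_single 0, kummerTerm_zero]
  intro k hk
  simp [kummerTerm, hk]

/-- The derivative of Kummer's function in its last argument. -/
noncomputable def kummerD (a b s : ℝ) : ℝ := a / b * kummerM (a + 1) (b + 1) s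

/-- The second derivative of Kummer's function in its last argument. -/
noncomputable def kummerDD (a b s : ℝ) : ℝ :=
  a / b * ((a + 1) / (b + 1) * kummerM (a + 1 + 1) (b + 1 + 1) s)

lemma hasDerivAt_kummerD {b : ℝ} (hb : 0 < b) (a s : ℝ) :
    HasDerivAt (kummerD a b) (kummerDD a b s) s :=
  (hasDerivAt_kummerM (by positivity : 0 < b + 1) (a + 1) s).const_mul (a / b)

lemma contDiff_kummerD {b : ℝ} (hb : 0 < b) (a : ℝ) : ContDiff ℝ ∞ (kummerD a b) :=
  contDiff_const.mul (contDiff_kummerM (by positivity) _)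

/-- This is Kummer's equation coefficient by coefficient, in the form `(b + θ) M' = (a + θ) M` with
`θ = s d/ds`, which multiplies the `k`-th term by `k`. -/
lemma add_mul_kummerTerm {b : ℝ} (hb : 0 < b) (a s : ℝ) (k : ℕ) :
    (b + k) * (a / b * kummerTerm (a + 1) (b + 1) s k) = (a + k) * kummerTerm a b s k := by
  induction k with
  | zero => simp; field_simp
  | succ k ih =>
    rw [kummerTerm_succ hb, kummerTerm_succ (by positivity : 0 < b + 1)]
    have h2 : b + 1 + k ≠ 0 := by positivity
    have h3 : b + k ≠ 0 := by positivity
    have h4 : (k : ℝ) + 1 ≠ 0 := by positivity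
    have : a / b * kummerTerm (a + 1) (b + 1) s k = (a + k) * kummerTerm a b s k / (b + k) := by
      rw [← ih]; field_simp
    rw [show ∀ x : ℝ, a / b * (kummerTerm (a + 1) (b + 1) s k * x) =
      a / b * kummerTerm (a + 1) (b + 1) s k * x from fun x => by ring, this]
    push_cast
    field_simp
    ring

/-- Kummer's differential equation. -/
lemma kummer_ode {b : ℝ} (hb : 0 < b) (a s : ℝ) :
    s * kummerDD a b s + (b - s) * kummerD a b s = a * kummerM a b s := by
  have hb1 : 0 < b + 1 := by positivity
  have hD : HasSum (fun k => a / b * kummerTerm (a + 1) (b + 1) s k) (kummerD a b s) :=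
    (hasSum_kummerM hb1 (a + 1) s).mul_left (a / b)
  have hDD : HasSum (fun k => a / b * ((a + 1) / (b + 1) * kummerTerm (a + 1 + 1) (b + 1 + 1) s k))
      (kummerDD a b s) :=
    ((hasSum_kummerM (by positivity : 0 < b + 1 + 1) (a + 1 + 1) s).mul_left _).mul_left _
  have hM := (hasSum_kummerM hb a s).mul_left a
  have hsD : HasSum (fun k : ℕ => k * kummerTerm a b s k) (s * kummerD a b s) := by
    rw [← hasSum_nat_add_iff' 1]
    simpa [succ_mul_kummerTerm_succ hb] using hD.mul_left s
  have hsDD : HasSum (fun k : ℕ => k * (a / b * kummerTerm (a + 1) (b + 1) s k))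
      (s * kummerDD a b s) := by
    rw [← hasSum_nat_add_iff' 1]
    simp only [Finset.range_one, Finset.sum_singleton, Nat.cast_zero, zero_mul, sub_zero]
    refine (hDD.mul_left s).congr_fun fun k => ?_
    push_cast
    linear_combination (a / b) * succ_mul_kummerTerm_succ hb1 (a + 1) s k
  have key := ((hsDD.add (hD.mul_left b)).sub (hsD.add hM)).unique
    ((hasSum_zero (α := ℝ) (β := ℕ)).congr_fun fun k => by
      linear_combination add_mul_kummerTerm hb a s k)
  linear_combination key

end GaussEigenvalue

/-! ### Monotonicity of Kummer's function and its smallest zero in the parameter -/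

namespace GaussEigenvalue

/-- With the integrating factor `s^b e^{-s}`, Kummer's equation becomes `(s^b e^{-s} M')' = a
s^{b-1} e^{-s} M`, which is nonpositive while `M ≥ 0`. -/
lemma kummerD_neg {a b S : ℝ} (ha : a < 0) (hb : 0 < b)
    (hM : ∀ s ∈ Icc 0 S, 0 ≤ kummerM a b s) {s : ℝ} (hs : s ∈ Ioc 0 S) : kummerD a b s < 0 := by
  let g : ℝ → ℝ := fun s => s ^ b * (Real.exp (-s) * kummerD a b s)
  have hg : ∀ s : ℝ, 0 < s →
      HasDerivAt g (s ^ (b - 1) * Real.exp (-s) * (a * kummerM a b s)) s := by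
    intro s hs
    have h1 := (Real.hasDerivAt_rpow_const (p := b) (Or.inl hs.ne')).mul
      (((hasDerivAt_neg s).exp).mul (hasDerivAt_kummerD hb a s))
    refine h1.congr_deriv ?_
    have h2 : s ^ b = s ^ (b - 1) * s := by
      rw [← Real.rpow_add_one hs.ne']; simp
    rw [h2, ← kummer_ode hb]
    simp
    ring
  have hanti : AntitoneOn g (Ioc 0 S) := by
    refine antitoneOn_of_deriv_nonpos (convex_Ioc 0 S)
      (fun x hx => (hg x hx.1).continuousAt.continuousWithinAt)
      (fun x hx => (hg x (interior_subset hx).1).differentiableAt.differentiableWithinAt)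
      fun x hx => ?_
    have hx' := interior_subset hx
    rw [(hg x hx'.1).deriv]
    have := Real.rpow_nonneg hx'.1.le (b - 1)
    exact mul_nonpos_of_nonneg_of_nonpos (by positivity)
      (mul_nonpos_of_nonpos_of_nonneg ha.le (hM x ⟨hx'.1.le, hx'.2⟩))
  have h0 : kummerD a b 0 < 0 := by
    simpa [kummerD] using div_neg_of_neg_of_pos ha hb
  -- The weighted derivative `g` vanishes at 0, so the strict sign is taken from `M'(0) = a/b < 0`
  -- at a nearby point `x > 0` and carried forward by monotonicity.
  have hev : ∀ᶠ x in nhdsWithin (0 : ℝ) (Ioi 0), kummerD a b x < 0 :=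
    nhdsWithin_le_nhds ((hasDerivAt_kummerD hb a 0).continuousAt.eventually_lt_const h0)
  obtain ⟨x, hx, hx0, hxs⟩ := (hev.and (Ioo_mem_nhdsGT hs.1)).exists
  have hgx : g x < 0 :=
    mul_neg_of_pos_of_neg (Real.rpow_pos_of_pos hx0 b)
      (mul_neg_of_pos_of_neg (Real.exp_pos _) hx)
  have hgs : g s < 0 := (hanti ⟨hx0, hxs.le.trans hs.2⟩ hs hxs.le).trans_lt hgx
  exact neg_of_mul_neg_right (neg_of_mul_neg_right hgs (Real.rpow_nonneg hs.1.le b))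
    (Real.exp_pos _).le

lemma strictAntiOn_kummerM {a b S : ℝ} (ha : a < 0) (hb : 0 < b)
    (hM : ∀ s ∈ Icc 0 S, 0 ≤ kummerM a b s) : StrictAntiOn (kummerM a b) (Icc 0 S) := by
  refine strictAntiOn_of_deriv_neg (convex_Icc 0 S)
    (differentiable_kummerM hb a).continuous.continuousOn fun x hx => ?_
  rw [interior_Icc] at hx
  rw [(hasDerivAt_kummerM hb a x).deriv]
  exact kummerD_neg ha hb hM ⟨hx.1, hx.2.le⟩

/-- If positivity of `l ↦ M(-l/2; b; ·)` on `[0, S]` fails for some `l ≥ 0`, then there is a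
smallest positive zero of `l ↦ M(-l/2; b; S)`, and for it the function is positive on `[0, S)`. -/
lemma exists_isLeast_kummerM_zero {b S : ℝ} (hb : 0 < b) (hS : 0 < S)
    (hne : ∃ l : ℝ, 0 ≤ l ∧ ∃ s ∈ Icc 0 S, kummerM (-l / 2) b s ≤ 0) :
    ∃ l : ℝ, IsLeast {l : ℝ | 0 < l ∧ kummerM (-l / 2) b S = 0} l ∧
      ∀ s ∈ Ico 0 S, 0 < kummerM (-l / 2) b s := by
  let T : Set ℝ := {l | 0 ≤ l ∧ ∃ s ∈ Icc 0 S, kummerM (-l / 2) b s ≤ 0}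
  have hcont : Continuous fun p : ℝ × ℝ => kummerM (-p.1 / 2) b p.2 :=
    (continuous_kummerM hb).comp (by fun_prop : Continuous fun p : ℝ × ℝ => (-p.1 / 2, p.2))
  have hTc : IsClosed T := by
    have h1 : IsClosed {p : ℝ × Icc (0 : ℝ) S | kummerM (-p.1 / 2) b p.2 ≤ 0} :=
      isClosed_le (hcont.comp (by fun_prop : Continuous fun p : ℝ × Icc (0 : ℝ) S =>
        (p.1, (p.2 : ℝ)))) continuous_const
    -- `T` is the projection of a closed set along the compact interval `[0, S]`, hence closed, so
    -- its infimum is attained.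
    convert (isClosed_Ici (a := (0 : ℝ))).inter (isClosedMap_fst_of_compactSpace _ h1) using 1
    ext l
    simp [T, and_assoc]
  have hTb : BddBelow T := ⟨0, fun l hl => hl.1⟩
  have hmem : sInf T ∈ T := hTc.csInf_mem hne hTb
  set l := sInf T with hl
  have hpos : ∀ m, 0 ≤ m → m < l → ∀ s ∈ Icc 0 S, 0 < kummerM (-m / 2) b s := by
    intro m hm hml s hs
    by_contra! h
    exact absurd (csInf_le hTb (show m ∈ T from ⟨hm, s, hs, h⟩)) (not_le.2 hml)
  have hl0 : 0 < l := by
    refine hmem.1.lt_of_ne fun h => ?_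
    obtain ⟨s, _, hs⟩ := hmem.2
    rw [← h] at hs
    norm_num at hs
  have hnn : ∀ s ∈ Icc 0 S, 0 ≤ kummerM (-l / 2) b s := by
    intro s hs
    have hc : Continuous fun m : ℝ => kummerM (-m / 2) b s :=
      hcont.comp (by fun_prop : Continuous fun m : ℝ => (m, s))
    refine ge_of_tendsto (hc.continuousAt.mono_left nhdsWithin_le_nhds :
      Filter.Tendsto _ (nhdsWithin l (Iio l)) _) ?_
    filter_upwards [Ioo_mem_nhdsLT hl0] with m hm
    exact (hpos m hm.1.le hm.2 s hs).le
  have hanti := strictAntiOn_kummerM (by linarith : -l / 2 < 0) hb hnn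
  -- Nonnegativity at the critical parameter, a limit of positive cases, forces strict decrease in
  -- `s`; a zero can then occur only at `s = S`.
  have hlt : ∀ s ∈ Ico 0 S, 0 < kummerM (-l / 2) b s := fun s hs =>
    (hnn S ⟨hS.le, le_rfl⟩).trans_lt (hanti ⟨hs.1, hs.2.le⟩ ⟨hS.le, le_rfl⟩ hs.2)
  refine ⟨l, ⟨⟨hl0, ?_⟩, ?_⟩, hlt⟩
  · obtain ⟨s, hs, hs0⟩ := hmem.2
    rcases hs.2.lt_or_eq with h | rfl
    · exact absurd hs0 (not_le.2 (hlt s ⟨hs.1, h⟩))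
    · exact le_antisymm hs0 (hnn s hs)
  · rintro m ⟨hm0, hm⟩
    by_contra! h
    exact (hpos m hm0.le h S ⟨hS.le, le_rfl⟩).ne' hm

end GaussEigenvalue

/-! ### Gaussian measure, radial functions and the weak eigenvalue equation -/

namespace GaussEigenvalue

variable {n : ℕ}

lemma continuous_gaussDensity (n : ℕ) : Continuous fun x : EuclideanSpace ℝ (Fin n) =>
    (2 * Real.pi) ^ (-(n : ℝ) / 2) * Real.exp (-‖x‖ ^ 2 / 2) := by fun_prop

instance : IsLocallyFiniteMeasure (gaussMeasure n) :=
  IsLocallyFiniteMeasure.withDensity_ofReal (continuous_gaussDensity n)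

lemma integral_gaussMeasure (g : EuclideanSpace ℝ (Fin n) → ℝ) :
    ∫ x, g x ∂gaussMeasure n =
      (2 * Real.pi) ^ (-(n : ℝ) / 2) * ∫ x, Real.exp (-‖x‖ ^ 2 / 2) * g x := by
  rw [gaussMeasure, integral_withDensity_eq_integral_toReal_smul
    (continuous_gaussDensity n).measurable.ennreal_ofReal (by simp), ← integral_const_mul]
  congr 1 with x
  rw [ENNReal.toReal_ofReal (by positivity), smul_eq_mul, mul_assoc]

lemma volume_absolutelyContinuous_gaussMeasure :
    (volume : Measure (EuclideanSpace ℝ (Fin n))) ≪ gaussMeasure n :=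
  withDensity_absolutelyContinuous' (continuous_gaussDensity n).measurable.ennreal_ofReal.aemeasurable
    (Filter.Eventually.of_forall fun x => by
      have : 0 < (2 * Real.pi) ^ (-(n : ℝ) / 2) * Real.exp (-‖x‖ ^ 2 / 2) := by positivity
      simpa using this)

instance : (gaussMeasure n).IsOpenPosMeasure :=
  volume_absolutelyContinuous_gaussMeasure.isOpenPosMeasure

/-- The radial function `x ↦ F (|x|² / 2)`. -/
noncomputable def radial (F : ℝ → ℝ) (x : EuclideanSpace ℝ (Fin n)) : ℝ := F (‖x‖ ^ 2 / 2)

lemma hasFDerivAt_radial {F : ℝ → ℝ} {F' : ℝ} {x : EuclideanSpace ℝ (Fin n)}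
    (h : HasDerivAt F F' (‖x‖ ^ 2 / 2)) : HasFDerivAt (radial F) (F' • innerSL ℝ x) x := by
  have h1 := (hasStrictFDerivAt_norm_sq x).hasFDerivAt.const_mul (1 / 2 : ℝ)
  have h2 := HasDerivAt.comp_hasFDerivAt (f := fun y : EuclideanSpace ℝ (Fin n) => ‖y‖ ^ 2 / 2) x h
    (h1.congr_of_eventuallyEq (Filter.Eventually.of_forall fun y => by ring))
  refine h2.congr_fderiv ?_
  ext v
  simp

lemma contDiff_radial {F : ℝ → ℝ} (h : ContDiff ℝ ∞ F) :
    ContDiff ℝ ∞ (radial F : EuclideanSpace ℝ (Fin n) → ℝ) :=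
  h.comp ((contDiff_norm_sq ℝ).div_const 2)

lemma inner_gradient_left' (w : EuclideanSpace ℝ (Fin n) → ℝ) (x v : EuclideanSpace ℝ (Fin n)) :
    inner ℝ (gradient w x) v = fderiv ℝ w x v := by
  rw [gradient, InnerProductSpace.toDual_symm_apply]

lemma gradient_radial {F : ℝ → ℝ} {F' : ℝ} {x : EuclideanSpace ℝ (Fin n)}
    (h : HasDerivAt F F' (‖x‖ ^ 2 / 2)) : gradient (radial F) x = F' • x := by
  refine ext_inner_right ℝ fun v => ?_
  rw [inner_gradient_left', (hasFDerivAt_radial h).fderiv]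
  simp [inner_smul_left]

lemma continuous_gradient {w : EuclideanSpace ℝ (Fin n) → ℝ} (hw : ContDiff ℝ ∞ w) :
    Continuous (gradient w) :=
  (InnerProductSpace.toDual ℝ _).symm.continuous.comp (hw.continuous_fderiv (by simp))

/-- Divergence theorem for the field `H(|x|²/2) x` and a compactly supported function. -/
lemma integral_radial_mul_fderiv_self {h h' : ℝ → ℝ} (hh : ∀ s, HasDerivAt h (h' s) s)
    (hh' : Continuous h') {w : EuclideanSpace ℝ (Fin n) → ℝ} (hw : ContDiff ℝ ∞ w)
    (hwc : HasCompactSupport w) :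
    ∫ x, radial h x * fderiv ℝ w x x =
      -∫ x, (n * radial h x + ‖x‖ ^ 2 * radial h' x) * w x := by
  have hhc : Continuous h := continuous_iff_continuousAt.2 fun s => (hh s).continuousAt
  have hrc : Continuous (radial h : EuclideanSpace ℝ (Fin n) → ℝ) := by unfold radial; fun_prop
  have hrc' : Continuous (radial h' : EuclideanSpace ℝ (Fin n) → ℝ) := by unfold radial; fun_prop
  have hdw : Continuous (fderiv ℝ w) := hw.continuous_fderiv (by simp)
  let e : Fin n → EuclideanSpace ℝ (Fin n) := fun i => EuclideanSpace.single i 1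
  let f : Fin n → EuclideanSpace ℝ (Fin n) → ℝ := fun i x => radial h x * x i
  have hf : ∀ i x, HasFDerivAt (f i)
      (radial h x • EuclideanSpace.proj i + x i • (radial h' x • innerSL ℝ x)) x := fun i x =>
    (hasFDerivAt_radial (hh _)).mul (EuclideanSpace.proj (𝕜 := ℝ) i).hasFDerivAt
  have hfd : ∀ i x, fderiv ℝ (f i) x (e i) = radial h x + x i ^ 2 * radial h' x := fun i x => by
    rw [(hf i x).fderiv]
    simp [e, EuclideanSpace.inner_single_right]
    ring
  have hfc : ∀ i, Continuous (f i) := fun i => by fun_prop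
  have hdwc : ∀ i, HasCompactSupport fun x => fderiv ℝ w x (e i) := fun i => hwc.fderiv_apply ℝ (e i)
  have hint1 : ∀ i, Integrable (fun x => f i x * fderiv ℝ w x (e i)) := fun i =>
    Continuous.integrable_of_hasCompactSupport (by fun_prop) (hdwc i).mul_left
  have hint2 : ∀ i, Integrable (fun x => fderiv ℝ (f i) x (e i) * w x) := fun i => by
    have := hw.continuous
    simp_rw [hfd]
    exact Continuous.integrable_of_hasCompactSupport (by fun_prop) hwc.mul_left
  have hparts : ∀ i, ∫ x, f i x * fderiv ℝ w x (e i) = -∫ x, fderiv ℝ (f i) x (e i) * w x :=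
    fun i => integral_mul_fderiv_eq_neg_fderiv_mul_of_integrable (hint2 i) (hint1 i)
      (Continuous.integrable_of_hasCompactSupport ((hfc i).mul hw.continuous) hwc.mul_left)
      (fun x _ => (hf i x).differentiableAt) (fun x _ => hw.differentiable (by simp) x)
  have h1 : ∀ x, radial h x * fderiv ℝ w x x = ∑ i, f i x * fderiv ℝ w x (e i) := fun x => by
    have hx : x = ∑ i, x i • e i := by
      ext j
      simp [e, Finset.sum_apply, Pi.single_apply]
    conv_lhs => rw [show fderiv ℝ w x x = fderiv ℝ w x (∑ i, x i • e i) by rw [← hx]]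
    simp [f, map_sum, Finset.mul_sum, mul_assoc]
  have h2 : ∀ x : EuclideanSpace ℝ (Fin n), (n * radial h x + ‖x‖ ^ 2 * radial h' x) * w x =
      ∑ i, fderiv ℝ (f i) x (e i) * w x := fun x => by
    simp_rw [hfd, ← Finset.sum_mul, Finset.sum_add_distrib, ← Finset.sum_mul,
      EuclideanSpace.real_norm_sq_eq]
    simp
  simp_rw [h1, h2]
  rw [integral_finsetSum _ fun i _ => hint1 i, integral_finsetSum _ fun i _ => hint2 i,
    ← Finset.sum_neg_distrib]
  exact Finset.sum_congr rfl fun i _ => hparts i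

/-- The radial solution `M(-l/2; n/2; |x|²/2)` of the Ornstein-Uhlenbeck eigenvalue equation. -/
noncomputable def kummerRadial (n : ℕ) (l : ℝ) : EuclideanSpace ℝ (Fin n) → ℝ :=
  radial (kummerM (-l / 2) ((n : ℝ) / 2))

lemma contDiff_kummerRadial (hn : 1 ≤ n) (l : ℝ) : ContDiff ℝ ∞ (kummerRadial n l) :=
  contDiff_radial (contDiff_kummerM (by positivity) _)

lemma gradient_kummerRadial (hn : 1 ≤ n) (l : ℝ) (x : EuclideanSpace ℝ (Fin n)) :
    gradient (kummerRadial n l) x = radial (kummerD (-l / 2) ((n : ℝ) / 2)) x • x :=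
  gradient_radial (hasDerivAt_kummerM (by positivity) _ _)

/-- Weak form of the eigenvalue equation for `kummerRadial`. -/
lemma integral_inner_gradient_kummerRadial (hn : 1 ≤ n) (l : ℝ)
    {w : EuclideanSpace ℝ (Fin n) → ℝ} (hw : ContDiff ℝ ∞ w) (hwc : HasCompactSupport w) :
    ∫ x, inner ℝ (gradient w x) (gradient (kummerRadial n l) x) ∂gaussMeasure n =
      l * ∫ x, w x * kummerRadial n l x ∂gaussMeasure n := by
  have hb : 0 < (n : ℝ) / 2 := by positivity
  set a := -l / 2 with ha
  set b := (n : ℝ) / 2 with hb'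
  -- The factor `e^{-s}` is the Gaussian density up to its constant. With `n = 2b` and `|x|² = 2s`,
  -- Kummer's equation turns the divergence `n h + 2s h'` into `2a e^{-s} M = -l e^{-s} M`.
  let h : ℝ → ℝ := fun s => Real.exp (-s) * kummerD a b s
  let h' : ℝ → ℝ := fun s => Real.exp (-s) * (kummerDD a b s - kummerD a b s)
  have hh : ∀ s, HasDerivAt h (h' s) s := fun s =>
    (((hasDerivAt_neg s).exp).mul (hasDerivAt_kummerD hb a s)).congr_deriv (by simp [h']; ring)
  have hh' : Continuous h' := by
    have h1 : Continuous (kummerD a b) := (contDiff_kummerD hb a).continuous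
    have h2 : Continuous (kummerDD a b) := by
      have := (differentiable_kummerM (by positivity : 0 < b + 1 + 1) (a + 1 + 1)).continuous
      unfold kummerDD
      fun_prop
    fun_prop
  have key := integral_radial_mul_fderiv_self hh hh' hw hwc
  rw [integral_gaussMeasure, integral_gaussMeasure, mul_left_comm l]
  congr 1
  rw [← integral_const_mul]
  calc _ = ∫ x, radial h x * fderiv ℝ w x x := by
        congr 1 with x
        rw [gradient_kummerRadial hn, inner_smul_right, inner_gradient_left']
        simp only [radial, h, ha, hb', neg_div]
        ring
    _ = _ := by
        rw [key, ← integral_neg]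
        congr 1 with x
        have := kummer_ode hb a (‖x‖ ^ 2 / 2)
        simp only [kummerRadial, radial, h, h', neg_div, ← hb']
        rw [show -(l / 2) = a by rw [ha]; ring, show (n : ℝ) = 2 * b by rw [hb']; ring,
          show l = -2 * a by rw [ha]; ring]
        linear_combination (-2 * Real.exp (-(‖x‖ ^ 2 / 2)) * w x) * this

end GaussEigenvalue

/-! ### Lower bound for Rayleigh quotients -/

namespace GaussEigenvalue

variable {n : ℕ}

namespace IsTestFunction

variable {Ω : Set (EuclideanSpace ℝ (Fin n))} {φ : EuclideanSpace ℝ (Fin n) → ℝ}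

lemma eq_zero (h : IsTestFunction Ω φ) {x : EuclideanSpace ℝ (Fin n)} (hx : x ∉ Ω) : φ x = 0 :=
  image_eq_zero_of_notMem_tsupport fun hx' => hx (h.tsupport_subset hx')

lemma gradient_eq_zero_of_notMem_tsupport {x : EuclideanSpace ℝ (Fin n)} (hx : x ∉ tsupport φ) :
    gradient φ x = 0 := by
  rw [gradient, fderiv_of_notMem_tsupport _ hx, map_zero]

lemma gradient_eq_zero (h : IsTestFunction Ω φ) {x : EuclideanSpace ℝ (Fin n)} (hx : x ∉ Ω) :
    gradient φ x = 0 :=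
  gradient_eq_zero_of_notMem_tsupport fun hx' => hx (h.tsupport_subset hx')

lemma hasCompactSupport_gradient (h : IsTestFunction Ω φ) : HasCompactSupport (gradient φ) :=
  h.hasCompactSupport.mono' fun x hx => by
    by_contra hx'
    exact hx (gradient_eq_zero_of_notMem_tsupport hx')

lemma continuous_gradient (h : IsTestFunction Ω φ) : Continuous (gradient φ) :=
  GaussEigenvalue.continuous_gradient h.smooth

end IsTestFunction

/-- Barta's inequality: a positive solution on the ball bounds the Dirichlet energy from below. -/
lemma mul_integral_sq_le_integral_gradient_sq (hn : 1 ≤ n) {l : ℝ}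
    {Ω : Set (EuclideanSpace ℝ (Fin n))} (hpos : ∀ x ∈ Ω, 0 < kummerRadial n l x)
    {φ : EuclideanSpace ℝ (Fin n) → ℝ} (hφ : IsTestFunction Ω φ) :
    l * ∫ x, φ x ^ 2 ∂gaussMeasure n ≤ ∫ x, ‖gradient φ x‖ ^ 2 ∂gaussMeasure n := by
  set u := kummerRadial n l with hu
  have hus : ContDiff ℝ ∞ u := contDiff_kummerRadial hn l
  let w : EuclideanSpace ℝ (Fin n) → ℝ := fun x => φ x ^ 2 / u x
  have hwsupp : tsupport w ⊆ tsupport φ := closure_mono fun x hx => by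
    contrapose! hx
    simp only [Function.mem_support, not_not] at hx
    simp [w, hx]
  have hwc : HasCompactSupport w := hφ.hasCompactSupport.of_isClosed_subset isClosed_closure hwsupp
  have hw : ContDiff ℝ ∞ w := by
    rw [contDiff_iff_contDiffAt]
    intro x
    by_cases hx : x ∈ tsupport φ
    · exact (hφ.smooth.contDiffAt.pow 2).div hus.contDiffAt (hpos x (hφ.tsupport_subset hx)).ne'
    · exact contDiffAt_const.congr_of_eventuallyEq
        (notMem_tsupport_iff_eventuallyEq.1 fun h => hx (hwsupp h))
  have hwu : ∀ x, w x * u x = φ x ^ 2 := fun x => by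
    by_cases hx : x ∈ Ω
    · exact div_mul_cancel₀ _ (hpos x hx).ne'
    · simp [w, hφ.eq_zero hx]
  -- Picone's identity: `⟨∇w, ∇u⟩ = |∇φ|² - |∇φ - (φ/u)∇u|²` on the support of `φ`. The derivative
  -- of `w` is read off from `w u = φ²`.
  have hle : ∀ x, inner ℝ (gradient w x) (gradient u x) ≤ ‖gradient φ x‖ ^ 2 := fun x => by
    by_cases hx : x ∈ tsupport φ
    · have hux := (hpos x (hφ.tsupport_subset hx)).ne'
      have h1 : HasFDerivAt φ (fderiv ℝ φ x) x :=
        (hφ.smooth.differentiable (by simp) x).hasFDerivAt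
      have h2 : HasFDerivAt u (fderiv ℝ u x) x := (hus.differentiable (by simp) x).hasFDerivAt
      have h3 : fderiv ℝ w x (gradient u x) = 2 * (φ x / u x) * fderiv ℝ φ x (gradient u x) -
          (φ x / u x) ^ 2 * fderiv ℝ u x (gradient u x) := by
        have h5 := ((hw.differentiable (by simp) x).hasFDerivAt.mul h2).unique
          ((h1.pow 2).congr_of_eventuallyEq (Filter.Eventually.of_forall hwu))
        have h6 := DFunLike.congr_fun h5 (gradient u x)
        simp only [add_apply, smul_apply, smul_eq_mul, nsmul_eq_mul, w] at h6
        field_simp at h6 ⊢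
        norm_num at h6
        linarith
      have h4 : 0 ≤ ‖gradient φ x - (φ x / u x) • gradient u x‖ ^ 2 := by positivity
      rw [norm_sub_sq_real, norm_smul, mul_pow, Real.norm_eq_abs, sq_abs, inner_smul_right] at h4
      rw [inner_gradient_left', h3, ← inner_gradient_left', ← inner_gradient_left',
        real_inner_self_eq_norm_sq]
      linarith
    · rw [IsTestFunction.gradient_eq_zero_of_notMem_tsupport fun h => hx (hwsupp h),
        inner_zero_left]
      positivity
  have key := integral_inner_gradient_kummerRadial hn l hw hwc
  simp_rw [← hu, hwu] at key
  rw [← key]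
  have hgw : IsTestFunction univ w := ⟨hw, hwc, subset_univ _⟩
  refine integral_mono ?_ ?_ hle
  · refine Continuous.integrable_of_hasCompactSupport
      (hgw.continuous_gradient.inner (continuous_gradient hus)) ?_
    exact hgw.hasCompactSupport_gradient.mono fun x hx hx' => hx (by simp [hx'])
  · refine Continuous.integrable_of_hasCompactSupport (hφ.continuous_gradient.norm.pow 2) ?_
    exact hφ.hasCompactSupport_gradient.mono fun x hx hx' => hx (by simp [hx'])

lemma setIntegral_sq_eq {Ω : Set (EuclideanSpace ℝ (Fin n))} {φ : EuclideanSpace ℝ (Fin n) → ℝ}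
    (hφ : IsTestFunction Ω φ) :
    ∫ x in Ω, φ x ^ 2 ∂gaussMeasure n = ∫ x, φ x ^ 2 ∂gaussMeasure n :=
  setIntegral_eq_integral_of_forall_compl_eq_zero fun x hx => by simp [hφ.eq_zero hx]

lemma setIntegral_gradient_sq_eq {Ω : Set (EuclideanSpace ℝ (Fin n))}
    {φ : EuclideanSpace ℝ (Fin n) → ℝ} (hφ : IsTestFunction Ω φ) :
    ∫ x in Ω, ‖gradient φ x‖ ^ 2 ∂gaussMeasure n = ∫ x, ‖gradient φ x‖ ^ 2 ∂gaussMeasure n :=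
  setIntegral_eq_integral_of_forall_compl_eq_zero fun x hx => by simp [hφ.gradient_eq_zero hx]

/-- Young's inequality on the cross term. The factor `1 + η` on the main term can be sent to 1 after
the approximation error has been removed. -/
lemma norm_sq_le_add {V : Type*} [NormedAddCommGroup V] [InnerProductSpace ℝ V] (v w : V) {η : ℝ}
    (hη : 0 < η) : ‖v‖ ^ 2 ≤ (1 + η) * ‖w‖ ^ 2 + (1 + 1 / η) * ‖v - w‖ ^ 2 := by
  have h1 : ‖v‖ ≤ ‖w‖ + ‖v - w‖ := by simpa using norm_add_le w (v - w)
  have h2 : ‖v‖ ^ 2 ≤ (‖w‖ + ‖v - w‖) ^ 2 := by gcongr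
  have h3 : 0 ≤ (η * ‖w‖ - ‖v - w‖) ^ 2 / η := by positivity
  have h4 : (η * ‖w‖ - ‖v - w‖) ^ 2 / η =
      η * ‖w‖ ^ 2 - 2 * ‖w‖ * ‖v - w‖ + 1 / η * ‖v - w‖ ^ 2 := by field_simp; ring
  linarith

lemma integral_norm_sq_le_add {X V : Type*} [MeasurableSpace X] {μ : Measure X}
    [NormedAddCommGroup V] [InnerProductSpace ℝ V] {v w : X → V} (hv : MemLp v 2 μ)
    (hw : MemLp w 2 μ) {η : ℝ} (hη : 0 < η) :
    ∫ x, ‖v x‖ ^ 2 ∂μ ≤ (1 + η) * ∫ x, ‖w x‖ ^ 2 ∂μ + (1 + 1 / η) * ∫ x, ‖v x - w x‖ ^ 2 ∂μ := by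
  have h1 := (hw.integrable_norm_pow (by simp)).const_mul (1 + η)
  have h2 := ((hv.sub hw).integrable_norm_pow (by simp)).const_mul (1 + 1 / η)
  rw [← integral_const_mul, ← integral_const_mul]
  refine (integral_mono (hv.integrable_norm_pow (by simp)) (h1.add h2)
    fun x => norm_sq_le_add (v x) (w x) hη).trans_eq ?_
  exact integral_add h1 h2

/-- A Poincaré inequality for test functions extends to `W^{1,2}_0`. -/
lemma MemW120.mul_integral_sq_le {Ω : Set (EuclideanSpace ℝ (Fin n))} {l : ℝ} (hl : 0 ≤ l)
    (htest : ∀ φ, IsTestFunction Ω φ →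
      l * ∫ x, φ x ^ 2 ∂gaussMeasure n ≤ ∫ x, ‖gradient φ x‖ ^ 2 ∂gaussMeasure n)
    {u : EuclideanSpace ℝ (Fin n) → ℝ}
    {G : EuclideanSpace ℝ (Fin n) → EuclideanSpace ℝ (Fin n)} (h : MemW120 Ω u G) :
    l * ∫ x in Ω, u x ^ 2 ∂gaussMeasure n ≤ ∫ x in Ω, ‖G x‖ ^ 2 ∂gaussMeasure n := by
  set I := ∫ x in Ω, ‖G x‖ ^ 2 ∂gaussMeasure n with hI
  have step : ∀ η : ℝ, 0 < η → l * ∫ x in Ω, u x ^ 2 ∂gaussMeasure n ≤ (1 + η) ^ 2 * I := by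
    intro η hη
    refine le_of_forall_pos_le_add fun δ hδ => ?_
    -- `K` dominates the coefficients of both approximation errors, `l (1 + 1/η)` and `(1 + η)(1 +
    -- 1/η)`.
    set K := ((1 + η) + l) * (1 + 1 / η) with hK
    have hKpos : 0 < K := by positivity
    obtain ⟨φ, hφ, hε⟩ := h.approx (δ / K) (by positivity)
    have hφL : MemLp φ 2 ((gaussMeasure n).restrict Ω) :=
      (hφ.smooth.continuous.memLp_of_hasCompactSupport hφ.hasCompactSupport).restrict Ω
    have hφG : MemLp (gradient φ) 2 ((gaussMeasure n).restrict Ω) :=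
      (hφ.continuous_gradient.memLp_of_hasCompactSupport hφ.hasCompactSupport_gradient).restrict Ω
    have h1 := integral_norm_sq_le_add h.memLp hφL hη
    have h2 := integral_norm_sq_le_add hφG h.memLp_grad hη
    have h3 := htest φ hφ
    rw [← setIntegral_sq_eq hφ, ← setIntegral_gradient_sq_eq hφ] at h3
    simp only [Real.norm_eq_abs, sq_abs] at h1
    simp_rw [norm_sub_rev (gradient φ _)] at h2
    set A := ∫ x in Ω, (u x - φ x) ^ 2 ∂gaussMeasure n
    set B := ∫ x in Ω, ‖G x - gradient φ x‖ ^ 2 ∂gaussMeasure n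
    set Iφ := ∫ x in Ω, ‖gradient φ x‖ ^ 2 ∂gaussMeasure n
    set Jφ := ∫ x in Ω, φ x ^ 2 ∂gaussMeasure n
    have hA : 0 ≤ A := integral_nonneg fun x => sq_nonneg _
    have hB : 0 ≤ B := integral_nonneg fun x => sq_nonneg _
    have hη' : 0 < 1 + 1 / η := by positivity
    calc l * ∫ x in Ω, u x ^ 2 ∂gaussMeasure n
        ≤ l * ((1 + η) * Jφ + (1 + 1 / η) * A) := by gcongr
      _ = (1 + η) * (l * Jφ) + l * (1 + 1 / η) * A := by ring
      _ ≤ (1 + η) * ((1 + η) * I + (1 + 1 / η) * B) + l * (1 + 1 / η) * A := by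
          gcongr
          exact h3.trans h2
      _ ≤ (1 + η) ^ 2 * I + K * (A + B) := by
          have e1 : 0 ≤ (1 + η) * (1 + 1 / η) * A := by positivity
          have e2 : 0 ≤ l * (1 + 1 / η) * B := by positivity
          rw [hK]
          linarith
      _ ≤ (1 + η) ^ 2 * I + δ := by
          gcongr
          calc K * (A + B) ≤ K * (δ / K) := by gcongr
            _ = δ := by field_simp
  have hlim : Filter.Tendsto (fun η : ℝ => (1 + η) ^ 2 * I) (nhdsWithin 0 (Ioi 0)) (nhds I) := by
    have : Continuous fun η : ℝ => (1 + η) ^ 2 * I := by fun_prop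
    simpa using (this.tendsto 0).mono_left nhdsWithin_le_nhds
  exact ge_of_tendsto hlim (Filter.eventually_of_mem self_mem_nhdsWithin step)

/-- The values of the Rayleigh quotient on the nonzero elements of `W^{1,2}_0(Ω, γ)`. -/
def rayleighSet (Ω : Set (EuclideanSpace ℝ (Fin n))) : Set ℝ :=
  {q : ℝ | ∃ u G, MemW120 Ω u G ∧ ¬ (u =ᵐ[(gaussMeasure n).restrict Ω] 0) ∧
    q = (∫ x in Ω, ‖G x‖ ^ 2 ∂(gaussMeasure n)) / (∫ x in Ω, u x ^ 2 ∂(gaussMeasure n))}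

lemma lambdaGamma_eq_sInf (Ω : Set (EuclideanSpace ℝ (Fin n))) :
    lambdaGamma Ω = sInf (rayleighSet Ω) := rfl

lemma le_of_mem_rayleighSet (hn : 1 ≤ n) {l : ℝ} (hl : 0 ≤ l)
    {Ω : Set (EuclideanSpace ℝ (Fin n))} (hpos : ∀ x ∈ Ω, 0 < kummerRadial n l x) {q : ℝ}
    (hq : q ∈ rayleighSet Ω) : l ≤ q := by
  obtain ⟨u, G, h, hne, rfl⟩ := hq
  have hint : Integrable (fun x => u x ^ 2) ((gaussMeasure n).restrict Ω) := by
    simpa using h.memLp.integrable_norm_pow (by simp)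
  have hJ : 0 < ∫ x in Ω, u x ^ 2 ∂gaussMeasure n := by
    refine (integral_nonneg fun x => sq_nonneg _).lt_of_ne fun h0 => hne ?_
    have := (integral_eq_zero_iff_of_nonneg (fun x => sq_nonneg _) hint).1 h0.symm
    filter_upwards [this] with x hx
    simpa using hx
  rw [le_div_iff₀ hJ]
  exact h.mul_integral_sq_le hl fun φ hφ => mul_integral_sq_le_integral_gradient_sq hn hpos hφ

lemma sq_norm_div_two_lt {R : ℝ} (hR : 0 < R) {x : EuclideanSpace ℝ (Fin n)} :
    ‖x‖ ^ 2 / 2 < R ^ 2 / 2 ↔ x ∈ Metric.ball (0 : EuclideanSpace ℝ (Fin n)) R := by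
  rw [mem_ball_zero_iff, div_lt_div_iff_of_pos_right two_pos,
    pow_lt_pow_iff_left₀ (norm_nonneg _) hR.le two_ne_zero]

/-- Were Kummer's function positive for every `l ≥ 0`, Barta's inequality would bound all `l` by the
Rayleigh quotient of one fixed bump function; `l = (I + 1)/J` exceeds it. -/
lemma exists_kummerM_nonpos (hn : 1 ≤ n) {R : ℝ} (hR : 0 < R) :
    ∃ l : ℝ, 0 ≤ l ∧ ∃ s ∈ Icc 0 (R ^ 2 / 2), kummerM (-l / 2) ((n : ℝ) / 2) s ≤ 0 := by
  by_contra! hcon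
  let f : ContDiffBump (0 : EuclideanSpace ℝ (Fin n)) := ⟨R / 4, R / 2, by positivity, by linarith⟩
  have hf : IsTestFunction (Metric.ball (0 : EuclideanSpace ℝ (Fin n)) R) f :=
    ⟨f.contDiff, f.hasCompactSupport, by
      rw [f.tsupport_eq]
      exact Metric.closedBall_subset_ball (by simp [f]; linarith)⟩
  have hJ : 0 < ∫ x, f x ^ 2 ∂gaussMeasure n := by
    refine Continuous.integral_pos_of_hasCompactSupport_nonneg_nonzero (x := 0)
      (f.continuous.pow 2) ?_ (fun x => sq_nonneg _) (by simp [f.one_of_mem_closedBall (Metric.mem_closedBall_self f.rIn_pos.le)])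
    exact f.hasCompactSupport.mono fun x hx hx' => hx (by simp [hx'])
  set J := ∫ x, f x ^ 2 ∂gaussMeasure n
  set I := ∫ x, ‖gradient f x‖ ^ 2 ∂gaussMeasure n
  have hI : 0 ≤ I := integral_nonneg fun x => sq_nonneg _
  have := mul_integral_sq_le_integral_gradient_sq hn (l := (I + 1) / J)
    (fun x hx => hcon _ (by positivity) _ ⟨by positivity, ((sq_norm_div_two_lt hR).2 hx).le⟩) hf
  have h2 : (I + 1) / J * J = I + 1 := by field_simp
  linarith

end GaussEigenvalue

/-! ### Truncation near the sphere and attainment of the eigenvalue -/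

namespace GaussEigenvalue

variable {n : ℕ}

lemma deriv_smoothTransition_eq_zero {y : ℝ} (hy : y < 0 ∨ 1 < y) :
    deriv Real.smoothTransition y = 0 := by
  rcases hy with hy | hy
  · rw [(show Real.smoothTransition =ᶠ[nhds y] fun _ => 0 from
      Filter.eventually_of_mem (Iio_mem_nhds hy) fun z hz =>
        Real.smoothTransition.zero_of_nonpos (le_of_lt hz)).deriv_eq, deriv_const]
  · rw [(show Real.smoothTransition =ᶠ[nhds y] fun _ => 1 from
      Filter.eventually_of_mem (Ioi_mem_nhds hy) fun z hz =>
        Real.smoothTransition.one_of_one_le (le_of_lt hz)).deriv_eq, deriv_const]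

lemma exists_abs_deriv_smoothTransition_le : ∃ C, ∀ y, |deriv Real.smoothTransition y| ≤ C := by
  have hc : Continuous (deriv Real.smoothTransition) :=
    (Real.smoothTransition.contDiff (n := 1)).continuous_deriv le_rfl
  obtain ⟨C, hC⟩ := isCompact_Icc.exists_bound_of_continuousOn (s := Icc (0 : ℝ) 1) hc.continuousOn
  refine ⟨max C 0, fun y => ?_⟩
  by_cases hy : y ∈ Icc (0 : ℝ) 1
  · exact (hC y hy).trans (le_max_left _ _)
  · rw [mem_Icc, not_and_or, not_le, not_le] at hy
    simp [deriv_smoothTransition_eq_zero hy]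

/-- Smooth truncation of `F` near `S`. -/
noncomputable def cutoff (F : ℝ → ℝ) (S m s : ℝ) : ℝ :=
  Real.smoothTransition (m * (S - s) - 1) * F s

/-- The derivative of `cutoff F S m`. -/
noncomputable def cutoffDeriv (F F' : ℝ → ℝ) (S m s : ℝ) : ℝ :=
  deriv Real.smoothTransition (m * (S - s) - 1) * (-m) * F s +
    Real.smoothTransition (m * (S - s) - 1) * F' s

lemma hasDerivAt_cutoff {F F' : ℝ → ℝ} {s : ℝ} (hF : HasDerivAt F (F' s) s) (S m : ℝ) :
    HasDerivAt (cutoff F S m) (cutoffDeriv F F' S m s) s := by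
  have h1 : HasDerivAt (fun s => m * (S - s) - 1) (-m) s := by
    simpa using (((hasDerivAt_id s).const_sub S).const_mul m).sub_const 1
  have h2 := ((Real.smoothTransition.contDiff (n := 1)).differentiable one_ne_zero
    (m * (S - s) - 1)).hasDerivAt
  exact (h2.comp s h1).mul hF

lemma contDiff_cutoff {F : ℝ → ℝ} (hF : ContDiff ℝ ∞ F) (S m : ℝ) :
    ContDiff ℝ ∞ (cutoff F S m) :=
  ((Real.smoothTransition.contDiff (n := ⊤)).comp (by fun_prop)).mul hF

lemma cutoff_eq_zero {F : ℝ → ℝ} {S m s : ℝ} (h : m * (S - s) ≤ 1) : cutoff F S m s = 0 := by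
  rw [cutoff, Real.smoothTransition.zero_of_nonpos (by linarith), zero_mul]

lemma cutoff_eq {F : ℝ → ℝ} {S m s : ℝ} (h : 2 ≤ m * (S - s)) : cutoff F S m s = F s := by
  rw [cutoff, Real.smoothTransition.one_of_one_le (by linarith), one_mul]

lemma cutoffDeriv_eq {F F' : ℝ → ℝ} {S m s : ℝ} (h : 2 < m * (S - s)) :
    cutoffDeriv F F' S m s = F' s := by
  rw [cutoffDeriv, Real.smoothTransition.one_of_one_le (by linarith),
    deriv_smoothTransition_eq_zero (Or.inr (by linarith))]
  simp

lemma abs_cutoff_le {F : ℝ → ℝ} {S m s C : ℝ} (h : |F s| ≤ C) : |cutoff F S m s| ≤ C := by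
  rw [cutoff, abs_mul, abs_of_nonneg (Real.smoothTransition.nonneg _)]
  exact (mul_le_of_le_one_left (abs_nonneg _) (Real.smoothTransition.le_one _)).trans h

/-- Differentiating the cutoff costs a factor `m`, but only where `S - s ≤ 2/m`. There the linear
vanishing of `F` at `S` gives `|F| ≤ 2C'/m`, so the bound does not depend on `m`. -/
lemma abs_cutoffDeriv_le {F F' : ℝ → ℝ} {S m s C C' : ℝ} (hm : 0 < m)
    (hC : ∀ y, |deriv Real.smoothTransition y| ≤ C) (hF' : |F' s| ≤ C')
    (hF : |F s| ≤ C' * (S - s)) : |cutoffDeriv F F' S m s| ≤ C * (2 * C') + C' := by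
  have hC' : 0 ≤ C' := (abs_nonneg _).trans hF'
  have hC0 : 0 ≤ C := (abs_nonneg _).trans (hC 0)
  refine (abs_add_le _ _).trans (add_le_add ?_ ?_)
  · rw [mul_assoc, abs_mul]
    by_cases h : 1 < m * (S - s) - 1
    · rw [deriv_smoothTransition_eq_zero (Or.inr h)]
      simp; positivity
    · refine mul_le_mul (hC _) ?_ (abs_nonneg _) hC0
      rw [abs_mul, abs_neg, abs_of_pos hm]
      calc m * |F s| ≤ m * (C' * (S - s)) := by gcongr
        _ = m * (S - s) * C' := by ring
        _ ≤ 2 * C' := by gcongr; linarith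
  · rw [abs_mul, abs_of_nonneg (Real.smoothTransition.nonneg _)]
    exact (mul_le_of_le_one_left (abs_nonneg _) (Real.smoothTransition.le_one _)).trans hF'

/-- Dominated convergence with a constant majorant on a ball of finite measure. Eventual equality
suffices because the truncations are stationary at each interior radius. -/
lemma setIntegral_radial_tendsto {R C : ℝ} (hR : 0 < R) {p : ℕ → ℝ → ℝ} {p₀ : ℝ → ℝ}
    (hp : ∀ k, Continuous (p k)) (hC : ∀ k, ∀ s ∈ Ico 0 (R ^ 2 / 2), |p k s| ≤ C)
    (hlim : ∀ s ∈ Ico 0 (R ^ 2 / 2), ∀ᶠ k in Filter.atTop, p k s = p₀ s) :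
    Filter.Tendsto (fun k => ∫ x in Metric.ball (0 : EuclideanSpace ℝ (Fin n)) R,
        radial (p k) x ∂gaussMeasure n) Filter.atTop
      (nhds (∫ x in Metric.ball (0 : EuclideanSpace ℝ (Fin n)) R, radial p₀ x ∂gaussMeasure n)) := by
  have hmem : ∀ x ∈ Metric.ball (0 : EuclideanSpace ℝ (Fin n)) R,
      ‖x‖ ^ 2 / 2 ∈ Ico 0 (R ^ 2 / 2) := fun x hx => ⟨by positivity, (sq_norm_div_two_lt hR).2 hx⟩
  refine tendsto_integral_of_dominated_convergence (fun _ => C) (fun k => ?_) ?_ (fun k => ?_) ?_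
  · have := hp k
    exact (show Continuous (radial (p k)) by unfold radial; fun_prop).aestronglyMeasurable
  · exact integrableOn_const (measure_ball_lt_top.ne)
  · filter_upwards [ae_restrict_mem measurableSet_ball] with x hx
    exact hC k _ (hmem x hx)
  · filter_upwards [ae_restrict_mem measurableSet_ball] with x hx
    exact tendsto_const_nhds.congr' ((hlim _ (hmem x hx)).mono fun k hk => hk.symm)

/-- Restrictions of smooth functions to balls belong to `W^{1,2}`. -/
lemma memW12_ball {u : EuclideanSpace ℝ (Fin n) → ℝ} (hu : ContDiff ℝ ∞ u) (R : ℝ) :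
    MemW12 (Metric.ball 0 R) u (gradient u) := by
  have hg := continuous_gradient hu
  have hball : gaussMeasure n (Metric.ball (0 : EuclideanSpace ℝ (Fin n)) R) < ⊤ :=
    measure_ball_lt_top
  have : IsFiniteMeasure ((gaussMeasure n).restrict (Metric.ball 0 R)) :=
    ⟨by rwa [Measure.restrict_apply_univ]⟩
  obtain ⟨C, hC⟩ := (isCompact_closedBall (0 : EuclideanSpace ℝ (Fin n)) R).exists_bound_of_continuousOn
    hu.continuous.continuousOn
  obtain ⟨C', hC'⟩ := (isCompact_closedBall (0 : EuclideanSpace ℝ (Fin n)) R).exists_bound_of_continuousOn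
    hg.continuousOn
  refine ⟨?_, ?_, ⟨?_, ?_, ?_⟩⟩
  · refine MemLp.of_bound hu.continuous.aestronglyMeasurable C ?_
    filter_upwards [ae_restrict_mem measurableSet_ball] with x hx
    exact hC x (Metric.ball_subset_closedBall hx)
  · refine MemLp.of_bound hg.aestronglyMeasurable C' ?_
    filter_upwards [ae_restrict_mem measurableSet_ball] with x hx
    exact hC' x (Metric.ball_subset_closedBall hx)
  · exact hu.continuous.locallyIntegrable.locallyIntegrableOn _
  · exact hg.locallyIntegrable.locallyIntegrableOn _
  · intro φ hφ
    have hs1 : ∫ x in Metric.ball 0 R, u x • gradient φ x = ∫ x, u x • gradient φ x :=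
      setIntegral_eq_integral_of_forall_compl_eq_zero fun x hx => by simp [hφ.gradient_eq_zero hx]
    have hs2 : ∫ x in Metric.ball 0 R, φ x • gradient u x = ∫ x, φ x • gradient u x :=
      setIntegral_eq_integral_of_forall_compl_eq_zero fun x hx => by simp [hφ.eq_zero hx]
    rw [hs1, hs2]
    have hi1 : Integrable fun x => u x • gradient φ x :=
      (hu.continuous.smul hφ.continuous_gradient).integrable_of_hasCompactSupport
        (hφ.hasCompactSupport_gradient.mono fun x hx hx' => hx (by simp [hx']))
    have hi2 : Integrable fun x => φ x • gradient u x :=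
      (hφ.smooth.continuous.smul hg).integrable_of_hasCompactSupport
        (hφ.hasCompactSupport.mono fun x hx hx' => hx (by simp [hx']))
    -- Pairing with a fixed vector `v` reduces the vector identity to scalar integration by parts in
    -- the direction `v`.
    refine ext_inner_left ℝ fun v => ?_
    rw [inner_neg_right, ← integral_inner hi1, ← integral_inner hi2]
    have e1 : ∀ x, inner ℝ v (u x • gradient φ x) = u x * fderiv ℝ φ x v := fun x => by
      rw [real_inner_comm, inner_smul_left, inner_gradient_left']; simp
    have e2 : ∀ x, inner ℝ v (φ x • gradient u x) = fderiv ℝ u x v * φ x := fun x => by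
      rw [real_inner_comm, inner_smul_left, inner_gradient_left']; simp [mul_comm]
    simp_rw [e1, e2]
    refine integral_mul_fderiv_eq_neg_fderiv_mul_of_integrable ?_ ?_ ?_
      (fun x _ => hu.differentiable (by simp) x) (fun x _ => hφ.smooth.differentiable (by simp) x)
    · simpa only [e2] using hi2.const_inner (𝕜 := ℝ) v
    · simpa only [e1] using hi1.const_inner (𝕜 := ℝ) v
    · exact Continuous.integrable_of_hasCompactSupport (hu.continuous.mul hφ.smooth.continuous)
        hφ.hasCompactSupport.mul_left

lemma isTestFunction_radial_cutoff {F : ℝ → ℝ} (hF : ContDiff ℝ ∞ F) {R m : ℝ} (hR : 0 < R)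
    (hm : 0 < m) : IsTestFunction (Metric.ball (0 : EuclideanSpace ℝ (Fin n)) R)
      (radial (cutoff F (R ^ 2 / 2) m)) := by
  -- On the closed set `K` one has `R²/2 - |x|²/2 ≥ 1/m`, so the support keeps away from the sphere.
  let K : Set (EuclideanSpace ℝ (Fin n)) := {x | 1 ≤ m * (R ^ 2 / 2 - ‖x‖ ^ 2 / 2)}
  have hK : IsClosed K := isClosed_le continuous_const (by fun_prop)
  have hsub : tsupport (radial (cutoff F (R ^ 2 / 2) m)) ⊆ K :=
    closure_minimal (fun x hx => by
      by_contra hx'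
      exact hx (cutoff_eq_zero (not_le.1 hx').le)) hK
  have hKR : K ⊆ Metric.ball (0 : EuclideanSpace ℝ (Fin n)) R := fun x hx => by
    rw [← sq_norm_div_two_lt hR]
    have : 0 < m * (R ^ 2 / 2 - ‖x‖ ^ 2 / 2) := one_pos.trans_le hx
    linarith [pos_of_mul_pos_right this hm.le]
  exact ⟨contDiff_radial (contDiff_cutoff hF _ _),
    (isCompact_closedBall (0 : EuclideanSpace ℝ (Fin n)) R).of_isClosed_subset isClosed_closure
      ((hsub.trans hKR).trans Metric.ball_subset_closedBall), hsub.trans hKR⟩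

/-- The radial solution vanishing on the sphere realises its eigenvalue as a Rayleigh quotient. -/
lemma mem_rayleighSet_of_kummerM_eq_zero (hn : 1 ≤ n) {R l : ℝ} (hR : 0 < R)
    (hzero : kummerM (-l / 2) ((n : ℝ) / 2) (R ^ 2 / 2) = 0)
    (hpos : ∀ s ∈ Ico 0 (R ^ 2 / 2), 0 < kummerM (-l / 2) ((n : ℝ) / 2) s) :
    l ∈ rayleighSet (Metric.ball (0 : EuclideanSpace ℝ (Fin n)) R) := by
  have hb : 0 < (n : ℝ) / 2 := by positivity
  set S := R ^ 2 / 2 with hS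
  have hSpos : 0 < S := by positivity
  set F := kummerM (-l / 2) ((n : ℝ) / 2) with hF
  set F' := kummerD (-l / 2) ((n : ℝ) / 2) with hF'
  have hFd : ∀ s, HasDerivAt F (F' s) s := hasDerivAt_kummerM hb _
  have hFs : ContDiff ℝ ∞ F := contDiff_kummerM hb _
  have hFc : Continuous F := hFs.continuous
  have hFc' : Continuous F' := (contDiff_kummerD hb _).continuous
  set u : EuclideanSpace ℝ (Fin n) → ℝ := kummerRadial n l with hu
  have hus : ContDiff ℝ ∞ u := contDiff_kummerRadial hn l
  obtain ⟨C, hC⟩ := exists_abs_deriv_smoothTransition_le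
  obtain ⟨C₀, hC₀⟩ := (isCompact_Icc (a := 0) (b := S)).exists_bound_of_continuousOn hFc.continuousOn
  obtain ⟨C₁, hC₁⟩ := (isCompact_Icc (a := 0) (b := S)).exists_bound_of_continuousOn
    hFc'.continuousOn
  -- Mean value inequality from the zero of `F` at `S`.
  have hFle : ∀ s ∈ Ico 0 S, |F s| ≤ C₁ * (S - s) := by
    intro s hs
    have := (convex_Icc 0 S).norm_image_sub_le_of_norm_hasDerivWithin_le
      (fun x _ => (hFd x).hasDerivWithinAt) hC₁ (x := S) (y := s) ⟨hSpos.le, le_rfl⟩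
      ⟨hs.1, hs.2.le⟩
    rwa [hzero, sub_zero, Real.norm_eq_abs, Real.norm_eq_abs, abs_sub_comm,
      abs_of_pos (sub_pos.2 hs.2)] at this
  let P : ℕ → ℝ → ℝ := fun k => cutoff F S (k + 1)
  let P' : ℕ → ℝ → ℝ := fun k => cutoffDeriv F F' S (k + 1)
  have hPd : ∀ k s, HasDerivAt (P k) (P' k s) s := fun k s => hasDerivAt_cutoff (hFd s) S _
  have hPs : ∀ k, ContDiff ℝ ∞ (P k) := fun k => contDiff_cutoff hFs S _
  have hPc : ∀ k, Continuous (P k) := fun k => (hPs k).continuous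
  have hPc' : ∀ k, Continuous (P' k) := fun k => by
    rw [show P' k = deriv (P k) from funext fun s => (hPd k s).deriv.symm]
    exact (hPs k).continuous_deriv (by simp)
  have hPb : ∀ k, ∀ s ∈ Ico 0 S, |P k s| ≤ C₀ := fun k s hs =>
    abs_cutoff_le (hC₀ s ⟨hs.1, hs.2.le⟩)
  set C₂ := C * (2 * C₁) + C₁ with hC₂
  have hPb' : ∀ k, ∀ s ∈ Ico 0 S, |P' k s| ≤ C₂ := fun k s hs =>
    abs_cutoffDeriv_le (by positivity) hC (hC₁ s ⟨hs.1, hs.2.le⟩) (hFle s hs)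
  have hev : ∀ s ∈ Ico 0 S, ∀ᶠ k : ℕ in Filter.atTop, P k s = F s ∧ P' k s = F' s := by
    intro s hs
    obtain ⟨N, hN⟩ := exists_nat_gt (2 / (S - s))
    have hSs : 0 < S - s := sub_pos.2 hs.2
    filter_upwards [Filter.eventually_ge_atTop N] with k hk
    have hk' : (N : ℝ) ≤ k := by exact_mod_cast hk
    have : 2 < ((k : ℝ) + 1) * (S - s) := by
      rw [div_lt_iff₀ hSs] at hN
      nlinarith
    exact ⟨cutoff_eq this.le, cutoffDeriv_eq this⟩
  have hφ : ∀ k, IsTestFunction (Metric.ball (0 : EuclideanSpace ℝ (Fin n)) R) (radial (P k)) :=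
    fun k => isTestFunction_radial_cutoff hFs hR (by positivity)
  have hgφ : ∀ k (x : EuclideanSpace ℝ (Fin n)), gradient (radial (P k)) x = radial (P' k) x • x :=
    fun k x => gradient_radial (hPd k _)
  have hgu : ∀ x, gradient u x = radial F' x • x := gradient_kummerRadial hn l
  have hb1 : ∀ {s}, s ∈ Ico 0 S → |F s| ≤ C₀ := fun hs => hC₀ _ ⟨hs.1, hs.2.le⟩
  have hb1' : ∀ {s}, s ∈ Ico 0 S → |F' s| ≤ C₁ := fun hs => hC₁ _ ⟨hs.1, hs.2.le⟩
  have lim1 := setIntegral_radial_tendsto (n := n) (C := (C₀ + C₀) ^ 2) hR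
    (p := fun k s => (F s - P k s) ^ 2) (p₀ := fun _ => 0)
    (fun k => by have := hPc k; fun_prop)
    (fun k s hs => by
      rw [abs_pow]
      gcongr
      exact (abs_sub _ _).trans (add_le_add (hb1 hs) (hPb k s hs)))
    (fun s hs => (hev s hs).mono fun k hk => by simp [hk.1])
  -- The factor `2 * s` is `|x|²`, since the gradient of a radial function is a multiple of `x`.
  have lim2 := setIntegral_radial_tendsto (n := n) (C := (C₁ + C₂) ^ 2 * (2 * S)) hR
    (p := fun k s => (F' s - P' k s) ^ 2 * (2 * s)) (p₀ := fun _ => 0)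
    (fun k => by have := hPc' k; fun_prop)
    (fun k s hs => by
      rw [abs_mul, abs_pow, abs_of_nonneg (by linarith [hs.1] : 0 ≤ 2 * s)]
      gcongr
      · linarith [hs.1]
      · exact (abs_sub _ _).trans (add_le_add (hb1' hs) (hPb' k s hs))
      · exact hs.2.le)
    (fun s hs => (hev s hs).mono fun k hk => by simp [hk.2])
  have lim3 := setIntegral_radial_tendsto (n := n) (C := C₂ * C₁ * (2 * S)) hR
    (p := fun k s => P' k s * F' s * (2 * s)) (p₀ := fun s => F' s * F' s * (2 * s))
    (fun k => by have := hPc' k; fun_prop)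
    (fun k s hs => by
      have h1 := hPb' k s hs
      have h2 := hb1' hs
      have h3 := (abs_nonneg _).trans h1
      have h4 := (abs_nonneg _).trans h2
      rw [abs_mul, abs_mul, abs_of_nonneg (by linarith [hs.1] : 0 ≤ 2 * s)]
      gcongr
      · linarith [hs.1]
      · exact hs.2.le)
    (fun s hs => (hev s hs).mono fun k hk => by simp [hk.2])
  have lim4 := setIntegral_radial_tendsto (n := n) (C := C₀ * C₀) hR
    (p := fun k s => P k s * F s) (p₀ := fun s => F s * F s)
    (fun k => by have := hPc k; fun_prop)
    (fun k s hs => by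
      have h1 := hPb k s hs
      have h2 := hb1 hs
      have h3 := (abs_nonneg _).trans h1
      rw [abs_mul]
      gcongr)
    (fun s hs => (hev s hs).mono fun k hk => by simp [hk.1])
  -- The weak equation needs a compactly supported test function, so `u` is tested against its
  -- truncations and the limit is taken on both sides.
  have henergy : ∫ x in Metric.ball 0 R, ‖gradient u x‖ ^ 2 ∂gaussMeasure n =
      l * ∫ x in Metric.ball 0 R, u x ^ 2 ∂gaussMeasure n := by
    have hk : ∀ k, ∫ x in Metric.ball (0 : EuclideanSpace ℝ (Fin n)) R,
        radial (fun s => P' k s * F' s * (2 * s)) x ∂gaussMeasure n =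
        l * ∫ x in Metric.ball (0 : EuclideanSpace ℝ (Fin n)) R,
          radial (fun s => P k s * F s) x ∂gaussMeasure n := by
      intro k
      have h1 : ∀ x, radial (fun s => P' k s * F' s * (2 * s)) x =
          inner ℝ (gradient (radial (P k)) x) (gradient u x) := fun x => by
        rw [hgφ, hgu, inner_smul_left, inner_smul_right, real_inner_self_eq_norm_sq]
        simp only [radial, conj_trivial]
        ring
      have h2 : ∀ x : EuclideanSpace ℝ (Fin n),
          radial (fun s => P k s * F s) x = radial (P k) x * u x := fun x => rfl
      simp_rw [h1, h2]
      rw [setIntegral_eq_integral_of_forall_compl_eq_zero fun x hx => by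
          rw [(hφ k).gradient_eq_zero hx, inner_zero_left],
        setIntegral_eq_integral_of_forall_compl_eq_zero fun x hx => by
          rw [(hφ k).eq_zero hx, zero_mul]]
      exact integral_inner_gradient_kummerRadial hn l (hφ k).smooth (hφ k).hasCompactSupport
    have := tendsto_nhds_unique (lim3.congr hk) (lim4.const_mul l)
    have h1 : ∀ x, ‖gradient u x‖ ^ 2 = radial (fun s => F' s * F' s * (2 * s)) x := fun x => by
      rw [hgu, norm_smul, mul_pow, Real.norm_eq_abs, sq_abs]
      simp only [radial]
      ring
    have h2 : ∀ x, u x ^ 2 = radial (fun s => F s * F s) x := fun x => by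
      simp only [hu, kummerRadial, radial]
      ring
    simpa only [h1, h2] using this
  have hupos : ∀ x ∈ Metric.ball (0 : EuclideanSpace ℝ (Fin n)) R, 0 < u x := fun x hx =>
    hpos _ ⟨by positivity, (sq_norm_div_two_lt hR).2 hx⟩
  have hne : ¬ u =ᵐ[(gaussMeasure n).restrict (Metric.ball 0 R)] 0 := by
    intro h
    rw [Filter.EventuallyEq, ae_restrict_iff' measurableSet_ball] at h
    have h0 : gaussMeasure n (Metric.ball (0 : EuclideanSpace ℝ (Fin n)) R) = 0 :=
      measure_mono_null (t := {x | ¬ (x ∈ Metric.ball 0 R → u x = 0)})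
        (fun x hx hx' => (hupos x hx).ne' (hx' hx)) h
    exact (Metric.measure_ball_pos _ _ hR).ne' h0
  have hmem : MemW120 (Metric.ball 0 R) u (gradient u) := by
    refine ⟨memW12_ball hus R, fun ε hε => ?_⟩
    have hlim := lim1.add lim2
    simp only [radial, integral_zero, add_zero] at hlim
    obtain ⟨k, hk⟩ := (hlim.eventually_lt_const hε).exists
    refine ⟨_, hφ k, ?_⟩
    have h1 : ∀ x, ‖gradient u x - gradient (radial (P k)) x‖ ^ 2 =
        (F' (‖x‖ ^ 2 / 2) - P' k (‖x‖ ^ 2 / 2)) ^ 2 * (2 * (‖x‖ ^ 2 / 2)) := fun x => by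
      rw [hgφ, hgu, ← sub_smul, norm_smul, mul_pow, Real.norm_eq_abs, sq_abs]
      simp only [radial]
      ring
    simp_rw [h1]
    exact hk
  refine ⟨u, gradient u, hmem, hne, ?_⟩
  have hJ : ∫ x in Metric.ball 0 R, u x ^ 2 ∂gaussMeasure n ≠ 0 := by
    intro h0
    refine hne ?_
    have hint : Integrable (fun x => u x ^ 2) ((gaussMeasure n).restrict (Metric.ball 0 R)) := by
      simpa using hmem.memLp.integrable_norm_pow (by simp)
    filter_upwards [(integral_eq_zero_iff_of_nonneg (fun x => sq_nonneg _) hint).1 h0] with x hx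
    simpa using hx
  rw [henergy, mul_div_cancel_right₀ _ hJ]

/-- The eigenvalue of a ball is the smallest positive zero of Kummer's function, and it bounds
from above every parameter for which Kummer's function is positive on the ball. -/
lemma isLeast_lambdaGamma_ball (hn : 1 ≤ n) {R : ℝ} (hR : 0 < R) :
    IsLeast {l : ℝ | 0 < l ∧ kummerM (-l / 2) ((n : ℝ) / 2) (R ^ 2 / 2) = 0}
      (lambdaGamma (Metric.ball (0 : EuclideanSpace ℝ (Fin n)) R)) ∧
    IsLeast (rayleighSet (Metric.ball (0 : EuclideanSpace ℝ (Fin n)) R))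
      (lambdaGamma (Metric.ball (0 : EuclideanSpace ℝ (Fin n)) R)) := by
  obtain ⟨l, hl, hpos⟩ := exists_isLeast_kummerM_zero (by positivity : 0 < (n : ℝ) / 2)
    (by positivity : 0 < R ^ 2 / 2) (exists_kummerM_nonpos hn hR)
  have hleast : IsLeast (rayleighSet (Metric.ball (0 : EuclideanSpace ℝ (Fin n)) R)) l :=
    ⟨mem_rayleighSet_of_kummerM_eq_zero hn hR hl.1.2 hpos, fun q hq =>
      le_of_mem_rayleighSet hn hl.1.1.le
        (fun x hx => hpos _ ⟨by positivity, (sq_norm_div_two_lt hR).2 hx⟩) hq⟩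
  rw [lambdaGamma_eq_sInf, hleast.csInf_eq]
  exact ⟨hl, hleast⟩

end GaussEigenvalue

/-! ### Certified numerical values for planar discs -/

namespace GaussEigenvalue

/-- Horner scheme for the series of `M(a; 1; s)`: the sum of the `m` terms of index `k, k + 1, …`
and of `c` times the next term, divided by the term of index `k`. -/
def kummerHorner (a s c : ℚ) : ℕ → ℕ → ℚ
  | _, 0 => c
  | k, m + 1 => 1 + (a + k) * s / ((k + 1) * (k + 1)) * kummerHorner a s c (k + 1) m

/-- The weight `c` stands for the tail: `c = 1` gives a plain partial sum, while `c = 2` replaces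
the tail by a geometric series of ratio 1/2. -/
lemma kummerTerm_mul_kummerHorner (a s c : ℚ) (k m : ℕ) :
    kummerTerm a 1 s k * kummerHorner a s c k m =
      ∑ j ∈ Finset.range m, kummerTerm a 1 s (k + j) + c * kummerTerm a 1 s (k + m) := by
  induction m generalizing k with
  | zero => simp [kummerHorner, mul_comm]
  | succ m ih =>
    have h := ih (k + 1)
    rw [Finset.sum_range_succ', add_zero, add_right_comm]
    simp only [add_assoc, add_comm 1, kummerHorner] at h ⊢
    rw [← add_assoc, ← h, kummerTerm_succ one_pos]
    push_cast
    ring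

/-- For `-1 < a < 0` the product `a (a+1) ⋯ (a+k)` has exactly one negative factor. -/
lemma kummerTerm_one_succ_nonpos {a s : ℝ} (ha : -1 < a) (ha' : a < 0) (hs : 0 ≤ s) (k : ℕ) :
    kummerTerm a 1 s (k + 1) ≤ 0 := by
  induction k with
  | zero =>
    rw [kummerTerm_succ one_pos]
    simpa using mul_nonpos_of_nonpos_of_nonneg ha'.le hs
  | succ k ih =>
    rw [kummerTerm_succ one_pos]
    refine mul_nonpos_of_nonpos_of_nonneg ih ?_
    have : 0 ≤ a + (k + 1 : ℕ) := by push_cast; linarith [(Nat.cast_nonneg k : (0 : ℝ) ≤ k)]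
    positivity

lemma kummerTerm_eq_mul_pow (a b s : ℝ) (k : ℕ) :
    kummerTerm a b s k = kummerTerm a b 1 k * s ^ k := by
  simp only [kummerTerm, one_pow]
  ring

lemma kummerM_one_anti {a s S : ℝ} (ha : -1 < a) (ha' : a < 0) (hs : 0 ≤ s) (hsS : s ≤ S) :
    kummerM a 1 S ≤ kummerM a 1 s := by
  refine (summable_kummerTerm one_pos a S).tsum_le_tsum (fun k => ?_)
    (summable_kummerTerm one_pos a s)
  change kummerTerm a 1 S k ≤ kummerTerm a 1 s k
  cases k with
  | zero => simp
  | succ k =>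
    rw [kummerTerm_eq_mul_pow a 1 S, kummerTerm_eq_mul_pow a 1 s]
    exact mul_le_mul_of_nonpos_left (by gcongr) (kummerTerm_one_succ_nonpos ha ha' zero_le_one k)

/-- All terms beyond the first are nonpositive, so dropping the tail can only increase the sum. -/
lemma kummerM_one_le_kummerHorner {a s : ℚ} (ha : -1 < a) (ha' : a < 0) (hs : 0 ≤ s) (m : ℕ) :
    kummerM a 1 s ≤ kummerHorner a s 1 0 m := by
  have h := kummerTerm_mul_kummerHorner a s 1 0 m
  simp only [zero_add, kummerTerm_zero, one_mul, Rat.cast_one] at h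
  rw [h, ← Finset.sum_range_succ, kummerM_eq_tsum,
    ← (summable_kummerTerm one_pos (a : ℝ) s).sum_add_tsum_nat_add (m + 1)]
  refine add_le_of_nonpos_right (tsum_nonpos fun k => ?_)
  exact kummerTerm_one_succ_nonpos (by exact_mod_cast ha) (by exact_mod_cast ha')
    (by exact_mod_cast hs) (k + m)

/-- From index `m` on, the ratio `(a+k)s/(k+1)²` is at most `s/(k+1) ≤ 1/2`; the terms being
nonpositive, the tail is at least twice its first term. -/
lemma kummerHorner_le_kummerM_one {a s : ℚ} (ha : -1 < a) (ha' : a < 0) (hs : 0 ≤ s) {m : ℕ}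
    (hm : 1 ≤ m) (hsm : 2 * s ≤ m + 1) : kummerHorner a s 2 0 m ≤ kummerM a 1 s := by
  have h := kummerTerm_mul_kummerHorner a s 2 0 m
  simp only [zero_add, kummerTerm_zero, one_mul] at h
  have ha1 : (-1 : ℝ) < a := by exact_mod_cast ha
  have ha2 : (a : ℝ) < 0 := by exact_mod_cast ha'
  have hs1 : (0 : ℝ) ≤ s := by exact_mod_cast hs
  have hsm1 : 2 * (s : ℝ) ≤ m + 1 := by exact_mod_cast hsm
  have hsum := (summable_kummerTerm one_pos (a : ℝ) s)
  have hm0 : kummerTerm a 1 s m ≤ 0 := by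
    obtain ⟨k, rfl⟩ := Nat.exists_eq_add_of_le' hm
    exact kummerTerm_one_succ_nonpos ha1 ha2 hs1 k
  have hgeom : ∀ j, kummerTerm a 1 s m * (1 / 2) ^ j ≤ kummerTerm a 1 s (j + m) := by
    intro j
    induction j with
    | zero => simp
    | succ j ih =>
      have hjm : kummerTerm a 1 s (j + m) ≤ 0 := by
        obtain ⟨k, hk⟩ := Nat.exists_eq_add_of_le' hm
        rw [hk, ← add_assoc]
        exact kummerTerm_one_succ_nonpos ha1 ha2 hs1 _
      have hq : ((a : ℝ) + (j + m : ℕ)) * s / ((1 + (j + m : ℕ)) * ((j + m : ℕ) + 1)) ≤ 1 / 2 := by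
        rw [div_le_iff₀ (by positivity)]
        push_cast
        have hj : (0 : ℝ) ≤ j := Nat.cast_nonneg j
        have hm' : (1 : ℝ) ≤ m := by exact_mod_cast hm
        nlinarith [mul_le_mul (by linarith : (a : ℝ) + (j + m) ≤ j + m + 1)
          (by linarith : 2 * (s : ℝ) ≤ j + m + 1) (by positivity) (by positivity)]
      rw [pow_succ, ← mul_assoc, add_right_comm, kummerTerm_succ one_pos]
      calc kummerTerm a 1 s m * (1 / 2) ^ j * (1 / 2)
          ≤ kummerTerm a 1 s (j + m) * (1 / 2) := by gcongr
        _ ≤ _ := mul_le_mul_of_nonpos_left hq hjm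
  rw [h, kummerM_eq_tsum, ← hsum.sum_add_tsum_nat_add m]
  gcongr
  calc ((2 : ℚ) : ℝ) * kummerTerm a 1 s m = ∑' j : ℕ, kummerTerm a 1 s m * (1 / 2) ^ j := by
        rw [tsum_mul_left, tsum_geometric_two]; push_cast; ring
    _ ≤ _ := (summable_geometric_two.mul_left _).tsum_le_tsum hgeom
        ((summable_nat_add_iff m).2 hsum)

/-- Rigorous enclosure of the eigenvalue of a planar disc. -/
lemma lambdaGamma_disc_mem_Icc {R : ℝ} (hR : 0 < R) {lo hi S : ℚ} (hS : R ^ 2 / 2 = S)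
    (hlo : 0 < lo) (hlo' : lo < 2) (hhi : 0 < hi) (hhi' : hi < 2) {m : ℕ} (hm : 1 ≤ m)
    (hSm : 2 * S ≤ m + 1) (h1 : 0 < kummerHorner (-lo / 2) S 2 0 m)
    (h2 : kummerHorner (-hi / 2) S 1 0 m < 0) :
    lambdaGamma (Metric.ball (0 : EuclideanSpace ℝ (Fin 2)) R) ∈ Icc (lo : ℝ) hi := by
  have hSpos : (0 : ℝ) < S := by rw [← hS]; positivity
  have hSq : 0 ≤ S := by exact_mod_cast hSpos.le
  obtain ⟨hl, hray⟩ := isLeast_lambdaGamma_ball (n := 2) (by norm_num) hR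
  have hb : (((2 : ℕ) : ℝ) / 2) = 1 := by norm_num
  rw [hb, hS] at hl
  have hF1 : 0 < kummerM (-(lo : ℝ) / 2) 1 S := by
    have := kummerHorner_le_kummerM_one (a := -lo / 2) (by linarith) (by linarith) hSq hm hSm
    push_cast at this
    exact lt_of_lt_of_le (by exact_mod_cast h1) this
  have hF2 : kummerM (-(hi : ℝ) / 2) 1 S < 0 := by
    have := kummerM_one_le_kummerHorner (a := -hi / 2) (by linarith) (by linarith) hSq m
    push_cast at this
    exact this.trans_lt (by exact_mod_cast h2)
  have hloR : (0 : ℝ) < lo := by exact_mod_cast hlo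
  have hloR' : (lo : ℝ) < 2 := by exact_mod_cast hlo'
  have hhiR : (0 : ℝ) < hi := by exact_mod_cast hhi
  constructor
  -- Lower bound: positivity at the boundary value `S` spreads to the whole disc by monotonicity in
  -- `s`, and Barta's inequality applies.
  · refine le_of_mem_rayleighSet (by norm_num) hloR.le (fun x hx => ?_) hray.1
    rw [kummerRadial, radial, hb]
    refine hF1.trans_le (kummerM_one_anti (by linarith) (by linarith) (by positivity) ?_)
    rw [← hS]
    exact ((sq_norm_div_two_lt hR).2 hx).le
  -- Upper bound: the value at `l = 0` is 1 and the value at `hi` is negative, so a zero lies in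
  -- between.
  · have hcont : ContinuousOn (fun l : ℝ => kummerM (-l / 2) 1 S) (Icc 0 hi) :=
      ((continuous_kummerM one_pos).comp
        (by fun_prop : Continuous fun l : ℝ => (-l / 2, (S : ℝ)))).continuousOn
    obtain ⟨l, hl1, hl2⟩ := intermediate_value_Icc' hhiR.le hcont
      (show (0 : ℝ) ∈ _ from ⟨hF2.le, by simp⟩)
    have hl0 : 0 < l := hl1.1.lt_of_ne fun h => by
      simp [← h] at hl2
    exact (hl.2 ⟨hl0, hl2⟩).trans hl1.2

lemma lambdaGamma_disc_four : lambdaGamma (Metric.ball (0 : EuclideanSpace ℝ (Fin 2)) 4) ∈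
    Icc (0.0045931899 : ℝ) 0.00459318999 := by
  -- The interval starts at the quoted decimal and has length `9 · 10⁻¹¹`, below the required
  -- `10⁻¹⁰`. The two signs are decided in exact rational arithmetic.
  have := lambdaGamma_disc_mem_Icc (R := 4) (by norm_num) (lo := 0.0045931899)
    (hi := 0.00459318999) (S := 8) (m := 45) (by norm_num) (by norm_num) (by norm_num)
    (by norm_num) (by norm_num) (by norm_num) (by norm_num) (by decide +kernel) (by decide +kernel)
  push_cast at this
  exact this

lemma lambdaGamma_disc_five : lambdaGamma (Metric.ball (0 : EuclideanSpace ℝ (Fin 2)) 5) ∈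
    Icc (0.0000848928 : ℝ) 0.00008489289 := by
  have := lambdaGamma_disc_mem_Icc (R := 5) (by norm_num) (lo := 0.0000848928)
    (hi := 0.00008489289) (S := 25 / 2) (m := 55) (by norm_num) (by norm_num) (by norm_num)
    (by norm_num) (by norm_num) (by norm_num) (by norm_num) (by decide +kernel) (by decide +kernel)
  push_cast at this
  exact this

lemma lambdaGamma_disc_six : lambdaGamma (Metric.ball (0 : EuclideanSpace ℝ (Fin 2)) 6) ∈
    Icc (0.0000005157 : ℝ) 0.00000051579 := by
  have := lambdaGamma_disc_mem_Icc (R := 6) (by norm_num) (lo := 0.0000005157)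
    (hi := 0.00000051579) (S := 18) (m := 65) (by norm_num) (by norm_num) (by norm_num)
    (by norm_num) (by norm_num) (by norm_num) (by norm_num) (by decide +kernel) (by decide +kernel)
  push_cast at this
  exact this

lemma rpow_neg_half_mem_Icc {x lo hi p q : ℝ} (hx : x ∈ Icc lo hi) (hlo : 0 < lo) (hp : 0 < p)
    (hq : 0 < q) (h1 : 1 ≤ lo * q ^ 2) (h2 : hi * p ^ 2 ≤ 1) :
    x ^ (-(1 / 2) : ℝ) ∈ Icc p q := by
  have hx0 : 0 < x := hlo.trans_le hx.1
  have hs : 0 < Real.sqrt x := Real.sqrt_pos.2 hx0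
  have hsq : Real.sqrt x ^ 2 = x := Real.sq_sqrt hx0.le
  rw [Real.rpow_neg hx0.le, ← Real.sqrt_eq_rpow]
  constructor
  · rw [le_inv_comm₀ hp hs, Real.sqrt_le_left (by positivity), inv_pow, le_inv_comm₀ hx0 (by positivity)]
    rw [le_inv_comm₀ (by positivity) hx0, ← one_div, le_div_iff₀ (by positivity)]
    nlinarith [hx.2, sq_nonneg p]
  · rw [inv_le_comm₀ hs hq]
    refine Real.le_sqrt_of_sq_le ?_
    rw [inv_pow, inv_le_iff_one_le_mul₀ (by positivity)]
    nlinarith [hx.1, sq_nonneg q]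

end GaussEigenvalue

open GaussEigenvalue in
theorem mainTheorem5 :
    -- location of the eigenvalue of a ball, in every dimension
    (∀ (n : ℕ) (R : ℝ), 1 ≤ n → 0 < R →
      IsLeast {l : ℝ | 0 < l ∧ GaussEigenvalue.kummerM (-l / 2) ((n : ℝ) / 2) (R ^ 2 / 2) = 0}
        (GaussEigenvalue.lambdaGamma (Metric.ball (0 : EuclideanSpace ℝ (Fin n)) R))) ∧
    -- the combination with `t = 1 / 2` of the discs of radii 4 and 6 is the disc of radius 5
    GaussEigenvalue.minkowskiComb (1 / 2) (Metric.ball (0 : EuclideanSpace ℝ (Fin 2)) 4)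
        (Metric.ball (0 : EuclideanSpace ℝ (Fin 2)) 6) =
      Metric.ball (0 : EuclideanSpace ℝ (Fin 2)) 5 ∧
    -- numerical values
    |GaussEigenvalue.lambdaGamma (Metric.ball (0 : EuclideanSpace ℝ (Fin 2)) 4)
        - 0.0045931899| < 1 / 10 ^ 10 ∧
    |GaussEigenvalue.lambdaGamma (Metric.ball (0 : EuclideanSpace ℝ (Fin 2)) 6)
        - 0.0000005157| < 1 / 10 ^ 10 ∧
    |GaussEigenvalue.lambdaGamma (Metric.ball (0 : EuclideanSpace ℝ (Fin 2)) 5)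
        - 0.0000848928| < 1 / 10 ^ 10 ∧
    |(GaussEigenvalue.lambdaGamma (Metric.ball (0 : EuclideanSpace ℝ (Fin 2)) 5) ^ (-(1 / 2) : ℝ)
        - 1 / 2 *
          GaussEigenvalue.lambdaGamma (Metric.ball (0 : EuclideanSpace ℝ (Fin 2)) 4)
            ^ (-(1 / 2) : ℝ)
        - 1 / 2 *
          GaussEigenvalue.lambdaGamma (Metric.ball (0 : EuclideanSpace ℝ (Fin 2)) 6)
            ^ (-(1 / 2) : ℝ)) - (-595)| < 1 / 2 ∧
    -- the inequality fails for these discs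
    GaussEigenvalue.lambdaGamma
        (GaussEigenvalue.minkowskiComb (1 / 2) (Metric.ball (0 : EuclideanSpace ℝ (Fin 2)) 4)
          (Metric.ball (0 : EuclideanSpace ℝ (Fin 2)) 6)) ^ (-(1 / 2) : ℝ) <
      (1 - 1 / 2) *
          GaussEigenvalue.lambdaGamma (Metric.ball (0 : EuclideanSpace ℝ (Fin 2)) 4)
            ^ (-(1 / 2) : ℝ)
        + 1 / 2 *
          GaussEigenvalue.lambdaGamma (Metric.ball (0 : EuclideanSpace ℝ (Fin 2)) 6)
            ^ (-(1 / 2) : ℝ) ∧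
    -- hence it is not true for all centrally symmetric (even convex) sets
    ¬ ∀ (Ω₀ Ω₁ : Set (EuclideanSpace ℝ (Fin 2))) (t : ℝ),
        Ω₀.Nonempty → IsOpen Ω₀ → Bornology.IsBounded Ω₀ → Convex ℝ Ω₀ → -Ω₀ = Ω₀ →
        Ω₁.Nonempty → IsOpen Ω₁ → Bornology.IsBounded Ω₁ → Convex ℝ Ω₁ → -Ω₁ = Ω₁ →
        t ∈ Set.Icc (0 : ℝ) 1 →
        (1 - t) * GaussEigenvalue.lambdaGamma Ω₀ ^ (-(1 / 2) : ℝ)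
            + t * GaussEigenvalue.lambdaGamma Ω₁ ^ (-(1 / 2) : ℝ) ≤
          GaussEigenvalue.lambdaGamma (GaussEigenvalue.minkowskiComb t Ω₀ Ω₁)
            ^ (-(1 / 2) : ℝ) := by
  have h4 := lambdaGamma_disc_four
  have h5 := lambdaGamma_disc_five
  have h6 := lambdaGamma_disc_six
  -- The brackets for the three radii place the difference between -595.2 and -594.9, which gives
  -- both the stated value and the strict inequality.
  have r4 := rpow_neg_half_mem_Icc h4 (p := 14.7) (q := 14.8) (by norm_num) (by norm_num)
    (by norm_num) (by norm_num) (by norm_num)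
  have r5 := rpow_neg_half_mem_Icc h5 (p := 108.5) (q := 108.6) (by norm_num) (by norm_num)
    (by norm_num) (by norm_num) (by norm_num)
  have r6 := rpow_neg_half_mem_Icc h6 (p := 1392.3) (q := 1392.6) (by norm_num) (by norm_num)
    (by norm_num) (by norm_num) (by norm_num)
  have hcomb : minkowskiComb (1 / 2) (Metric.ball (0 : EuclideanSpace ℝ (Fin 2)) 4)
      (Metric.ball (0 : EuclideanSpace ℝ (Fin 2)) 6) = Metric.ball 0 5 := by
    rw [minkowskiComb, smul_ball (by norm_num), smul_ball (by norm_num),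
      ball_add_ball (by norm_num) (by norm_num)]
    norm_num
  have hlt : lambdaGamma (minkowskiComb (1 / 2) (Metric.ball (0 : EuclideanSpace ℝ (Fin 2)) 4)
      (Metric.ball (0 : EuclideanSpace ℝ (Fin 2)) 6)) ^ (-(1 / 2) : ℝ) <
      (1 - 1 / 2) * lambdaGamma (Metric.ball (0 : EuclideanSpace ℝ (Fin 2)) 4) ^ (-(1 / 2) : ℝ)
        + 1 / 2 * lambdaGamma (Metric.ball (0 : EuclideanSpace ℝ (Fin 2)) 6) ^ (-(1 / 2) : ℝ) := by
    rw [hcomb]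
    linarith [r4.1, r5.2, r6.1]
  refine ⟨fun n R hn hR => (isLeast_lambdaGamma_ball hn hR).1, hcomb, ?_, ?_, ?_, ?_, hlt, ?_⟩
  · rw [abs_lt]
    constructor <;> linarith [h4.1, h4.2]
  · rw [abs_lt]
    constructor <;> linarith [h6.1, h6.2]
  · rw [abs_lt]
    constructor <;> linarith [h5.1, h5.2]
  · rw [abs_lt]
    constructor <;> linarith [r4.1, r4.2, r5.1, r5.2, r6.1, r6.2]
  · intro h
    refine absurd (h (Metric.ball 0 4) (Metric.ball 0 6) (1 / 2) ⟨0, by simp⟩ Metric.isOpen_ball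
      Metric.isBounded_ball (convex_ball _ _) (by simp) ⟨0, by simp⟩ Metric.isOpen_ball
      Metric.isBounded_ball (convex_ball _ _) (by simp) (by norm_num)) (not_le.2 hlt)
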